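/- Let ${\mathbf S}=\langle\{x,y\};\wedge,\sqcap\rangle$, where both $\wedge$ and $\sqcap$ are the meet operation of the chain $x<y$, and let ${\mathbf L}=\langle\{y,z\};\wedge,\sqcap\rangle$, where $\wedge$ is the meet operation of the chain $y<z$ and $\sqcap$ is the meet operation of the chain $z<y$. These are distributive bisemilattices, that is, $\wedge$ and $\sqcap$ are semilattice operations, each of which distributes over the other. Let ${\mathbf A}=\langle\{0,a,b,1\};\wedge,\sqcap,0,a,b,1\rangle$ be the four-element distributive bisemilattice ${\mathbf S}\times{\mathbf L}$ with all elements $0=(x,y)$, $a=(y,y)$, $b=(x,z)$, $1=(y,z)$ named by nullary operations. For a finite (non-empty) algebra ${\mathbf B}$, the homomorphism lattice ${\mathbf L}_{\mathbf B}$ is the set of finite (non-empty) members of the variety generated by ${\mathbf B}$ (the class of all algebras of the signature of ${\mathbf B}$ that satisfy every identity of ${\mathbf B}$) modulo the equivalence $\equiv$, ordered by $\to$; here ${\mathbf C}\to{\mathbf D}$ means that there is a homomorphism from ${\mathbf C}$ to ${\mathbf D}$, and ${\mathbf C}\equiv{\mathbf D}$ means that ${\mathbf C}\to{\mathbf D}$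 and ${\mathbf D}\to{\mathbf C}$. Then ${\mathbf L}_{\mathbf A}\cong{\mathbf N}_5$, where ${\mathbf N}_5$ is the five-element non-modular lattice. Moreover, every (non-empty) lattice with at most $5$ elements is isomorphic to ${\mathbf L}_{\mathbf B}$ for some finite algebra ${\mathbf B}$. -/

import Mathlib

namespace HomomorphismOrder

open scoped FirstOrder

/-- A finite (non-empty) algebra in the variety generated by the algebra `A` of signature `σ`,
i.e. a finite algebra satisfying every identity `s ≈ t` that holds in `A`.
The signature is a first-order language, assumed to have no relation symbols wherever it is used. -/
structure VarFin (σ : FirstOrder.Language.{0, 0}) (A : Type) [σ.Structure A] : Type 1 where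
  carrier : Type
  [str : σ.Structure carrier]
  [fin : Finite carrier]
  [nonempty : Nonempty carrier]
  sat : ∀ s t : σ.Term ℕ,
    (∀ v : ℕ → A, s.realize v = t.realize v) → ∀ v : ℕ → carrier, s.realize v = t.realize v

attribute [instance] VarFin.str VarFin.fin VarFin.nonempty

/-- The quasi-order `B → C` : there is a homomorphism from `B` to `C`. -/
instance VarFin.instPreorder (σ : FirstOrder.Language.{0, 0}) (A : Type) [σ.Structure A] :
    Preorder (VarFin σ A) where
  le B C := Nonempty (B.carrier →[σ] C.carrier)
  le_refl B := ⟨FirstOrder.Language.Hom.id σ B.carrier⟩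
  le_trans _ _ _ := fun ⟨f⟩ ⟨g⟩ => ⟨g.comp f⟩

/-- The homomorphism lattice of `A`: the quotient of the finite members of the variety generated
by `A` by homomorphic equivalence, ordered by existence of a homomorphism. -/
abbrev HomLattice (σ : FirstOrder.Language.{0, 0}) (A : Type) [σ.Structure A] : Type 1 :=
  Antisymmetrization (VarFin σ A) (· ≤ ·)

/-- The ordered set `K` is isomorphic to the homomorphism lattice of some finite algebra. -/
def IsHomLattice (K : Type*) [PartialOrder K] : Prop :=
  ∃ (σ : FirstOrder.Language.{0, 0}) (_ : σ.IsAlgebraic) (A : Type) (_ : σ.Structure A),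
    Finite A ∧ Nonempty A ∧ Nonempty (HomLattice σ A ≃o K)

/-- Two semilattice operations, each distributing over the other. -/
class DistribBisemilattice (α : Type*) where
  wedge : α → α → α
  sqcap : α → α → α
  wedge_idem : ∀ p, wedge p p = p
  wedge_comm : ∀ p q, wedge p q = wedge q p
  wedge_assoc : ∀ p q r, wedge (wedge p q) r = wedge p (wedge q r)
  sqcap_idem : ∀ p, sqcap p p = p
  sqcap_comm : ∀ p q, sqcap p q = sqcap q p
  sqcap_assoc : ∀ p q r, sqcap (sqcap p q) r = sqcap p (sqcap q r)
  wedge_sqcap : ∀ p q r, wedge p (sqcap q r) = sqcap (wedge p q) (wedge p r)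
  sqcap_wedge : ∀ p q r, sqcap p (wedge q r) = wedge (sqcap p q) (sqcap p r)

/-- The universe `{x, y}` of the two-element bisemilattice **S**. -/
inductive S
  | x
  | y

/-- The universe `{y, z}` of the two-element bisemilattice **L**. -/
inductive L
  | y
  | z

/-- In **S** both operations are the meet of the chain `x < y`. -/
def S.meet : S → S → S
  | .y, .y => .y
  | _, _ => .x

/-- In **L** the operation `∧` is the meet of the chain `y < z`. -/
def L.wedge : L → L → L
  | .z, .z => .z
  | _, _ => .y

/-- In **L** the operation `⊓` is the meet of the chain `z < y`. -/
def L.sqcap : L → L → L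
  | .y, .y => .y
  | _, _ => .z

instance : DistribBisemilattice S where
  wedge := S.meet
  sqcap := S.meet
  wedge_idem := by rintro ⟨⟩ <;> rfl
  wedge_comm := by rintro ⟨⟩ ⟨⟩ <;> rfl
  wedge_assoc := by rintro ⟨⟩ ⟨⟩ ⟨⟩ <;> rfl
  sqcap_idem := by rintro ⟨⟩ <;> rfl
  sqcap_comm := by rintro ⟨⟩ ⟨⟩ <;> rfl
  sqcap_assoc := by rintro ⟨⟩ ⟨⟩ ⟨⟩ <;> rfl
  wedge_sqcap := by rintro ⟨⟩ ⟨⟩ ⟨⟩ <;> rfl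
  sqcap_wedge := by rintro ⟨⟩ ⟨⟩ ⟨⟩ <;> rfl

instance : DistribBisemilattice L where
  wedge := L.wedge
  sqcap := L.sqcap
  wedge_idem := by rintro ⟨⟩ <;> rfl
  wedge_comm := by rintro ⟨⟩ ⟨⟩ <;> rfl
  wedge_assoc := by rintro ⟨⟩ ⟨⟩ ⟨⟩ <;> rfl
  sqcap_idem := by rintro ⟨⟩ <;> rfl
  sqcap_comm := by rintro ⟨⟩ ⟨⟩ <;> rfl
  sqcap_assoc := by rintro ⟨⟩ ⟨⟩ ⟨⟩ <;> rfl
  wedge_sqcap := by rintro ⟨⟩ ⟨⟩ ⟨⟩ <;> rfl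
  sqcap_wedge := by rintro ⟨⟩ ⟨⟩ ⟨⟩ <;> rfl

open DistribBisemilattice in
/-- The direct product of two distributive bisemilattices. -/
instance {α β : Type*} [DistribBisemilattice α] [DistribBisemilattice β] :
    DistribBisemilattice (α × β) where
  wedge p q := (wedge p.1 q.1, wedge p.2 q.2)
  sqcap p q := (sqcap p.1 q.1, sqcap p.2 q.2)
  wedge_idem _ := Prod.ext (wedge_idem _) (wedge_idem _)
  wedge_comm _ _ := Prod.ext (wedge_comm _ _) (wedge_comm _ _)
  wedge_assoc _ _ _ := Prod.ext (wedge_assoc _ _ _) (wedge_assoc _ _ _)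
  sqcap_idem _ := Prod.ext (sqcap_idem _) (sqcap_idem _)
  sqcap_comm _ _ := Prod.ext (sqcap_comm _ _) (sqcap_comm _ _)
  sqcap_assoc _ _ _ := Prod.ext (sqcap_assoc _ _ _) (sqcap_assoc _ _ _)
  wedge_sqcap _ _ _ := Prod.ext (wedge_sqcap _ _ _) (wedge_sqcap _ _ _)
  sqcap_wedge _ _ _ := Prod.ext (sqcap_wedge _ _ _) (sqcap_wedge _ _ _)

/-- Operation symbols of `⟨{0, a, b, 1}; ∧, ⊓, 0, a, b, 1⟩`, indexed by arity. -/
inductive Op : ℕ → Type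
  | zero : Op 0
  | a : Op 0
  | b : Op 0
  | one : Op 0
  | wedge : Op 2
  | sqcap : Op 2

/-- The signature of bisemilattices with four named elements. -/
def sig : FirstOrder.Language.{0, 0} := ⟨Op, fun _ => Empty⟩

/-- **S** × **L** with all four elements named by nullary operations. -/
instance : sig.Structure (S × L) where
  funMap {n} (f : Op n) := match n, f with
    | _, .zero => fun _ => (S.x, L.y)
    | _, .a => fun _ => (S.y, L.y)
    | _, .b => fun _ => (S.x, L.z)
    | _, .one => fun _ => (S.y, L.z)
    | _, .wedge => fun v => DistribBisemilattice.wedge (v 0) (v 1)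
    | _, .sqcap => fun v => DistribBisemilattice.sqcap (v 0) (v 1)
  RelMap {_} (r : Empty) := r.elim

/-- The universe of the pentagon. -/
inductive N5
  | bot
  | p
  | q
  | r
  | top

/-- Join in the pentagon `bot < p < q < top`, `bot < r < top`,
with `r` incomparable to `p` and `q`. -/
def N5.join : N5 → N5 → N5
  | .bot, u => u
  | u, .bot => u
  | .p, .p => .p
  | .p, .q => .q
  | .q, .p => .q
  | .q, .q => .q
  | .r, .r => .r
  | _, _ => .top

/-- Meet in the pentagon. -/
def N5.meet : N5 → N5 → N5
  | .top, u => u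
  | u, .top => u
  | .p, .p => .p
  | .p, .q => .p
  | .q, .p => .p
  | .q, .q => .q
  | .r, .r => .r
  | _, _ => .bot

/-- The pentagon lattice **N**₅ (with `u ≤ v` iff the join of `u` and `v` is `v`). -/
instance : Lattice N5 where
  le u v := N5.join u v = v
  sup := N5.join
  inf := N5.meet
  le_refl := by rintro ⟨⟩ <;> simp [N5.join]
  le_trans := by rintro ⟨⟩ ⟨⟩ ⟨⟩ <;> simp [N5.join]
  le_antisymm := by rintro ⟨⟩ ⟨⟩ <;> simp [N5.join]
  le_sup_left := by rintro ⟨⟩ ⟨⟩ <;> simp [N5.join]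
  le_sup_right := by rintro ⟨⟩ ⟨⟩ <;> simp [N5.join]
  sup_le := by rintro ⟨⟩ ⟨⟩ ⟨⟩ <;> simp [N5.join]
  inf_le_left := by rintro ⟨⟩ ⟨⟩ <;> simp [N5.join, N5.meet]
  inf_le_right := by rintro ⟨⟩ ⟨⟩ <;> simp [N5.join, N5.meet]
  le_inf := by rintro ⟨⟩ ⟨⟩ ⟨⟩ <;> simp [N5.join, N5.meet]

end HomomorphismOrder

/-! Suppose every element of A is named by a constant. Each B in the variety then receives a
canonical homomorphism from A, and B → C forces its kernel to be contained in the one for C. If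
moreover every finite B retracts onto its named elements, the converse holds: when ker B ≤ ker C
there is a composite B → A/ker B → C. Every congruence s is the kernel belonging to A/s, so the
homomorphism lattice is Con A (`nonempty_homLattice_orderIso_congr`).

For S × L a congruence is determined by whether it identifies the pairs (0,b), (a,1), (0,a). Two
implications among these leave five of the eight patterns, and they form N₅. In the ∧-order, the
retraction reads the first coordinate off a ≤ x and the second off e ≤ x. Here e is an atom over 0
lying below b or, if 0 = b in B, an atom over a lying below 1; being an atom makes its filter prime
for ⊓ (`VarFin.exists_filter_generator`).

The lattices with at most five elements are the chains, the square, the square with a new bottom or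
a new top, M₃ and N₅. A finite distributive lattice whose join-irreducibles have chains below them
is Con of an algebra on {0,1}^P, and retractions exist there (`isHomLattice_lowerSet`). This covers
the chains, the square and the square with a new bottom. M₃ is the partition lattice of three named
points. The square with a new top is not of forest type and is realised by the homomorphism order of
permutations whose sixth power is the identity. -/

namespace HomomorphismOrder

open scoped FirstOrder
open FirstOrder FirstOrder.Language FirstOrder.Language.Structure

/-! ### Homomorphism lattices, congruences and quotients -/

section Framework

variable {σ : FirstOrder.Language.{0, 0}} {A : Type} [σ.Structure A]

/-- A map between preorders that reflects and preserves the order and is surjective induces an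
isomorphism from the antisymmetrization. -/
theorem nonempty_homLattice_orderIso {K : Type*} [PartialOrder K] (φ : VarFin σ A → K)
    (hle : ∀ B C, B ≤ C ↔ φ B ≤ φ C) (hsurj : Function.Surjective φ) :
    Nonempty (HomLattice σ A ≃o K) := by
  have hmono : Monotone φ := fun B C h => (hle B C).1 h
  let e : HomLattice σ A ↪o K :=
    { toFun := Quotient.lift φ fun B C h => le_antisymm (hmono h.1) (hmono h.2)
      inj' := by
        rintro ⟨B⟩ ⟨C⟩ h
        exact Quotient.sound ⟨(hle B C).2 (le_of_eq h), (hle C B).2 (ge_of_eq h)⟩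
      map_rel_iff' := by
        rintro ⟨B⟩ ⟨C⟩
        exact (hle B C).symm }
  refine ⟨RelIso.ofSurjective e fun k => ?_⟩
  obtain ⟨B, hB⟩ := hsurj k
  exact ⟨toAntisymmetrization _ B, hB⟩

theorem IsHomLattice.of_orderIso {K K' : Type*} [PartialOrder K] [PartialOrder K']
    (h : IsHomLattice K) (e : K ≃o K') : IsHomLattice K' := by
  obtain ⟨σ, hσ, A, hA, hf, hn, ⟨i⟩⟩ := h
  exact ⟨σ, hσ, A, hA, hf, hn, ⟨i.trans e⟩⟩

/-- A setoid is compatible when it is preserved by all operations. -/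
def Compatible (σ : FirstOrder.Language.{0, 0}) {A : Type} [σ.Structure A] (s : Setoid A) : Prop :=
  ∀ {n : ℕ} (f : σ.Functions n) (x y : Fin n → A), (∀ i, s (x i) (y i)) → s (funMap f x) (funMap f y)

variable (σ A) in
/-- The congruences of an algebra, ordered by inclusion. -/
abbrev Congr := {s : Setoid A // Compatible σ s}

/-- A surjective homomorphic image of `A`, as a member of the variety generated by `A`. -/
def VarFin.quotient [σ.IsAlgebraic] [Finite A] [Nonempty A] (s : Congr σ A) : VarFin σ A :=
  letI : σ.Prestructure s.1 :=
    { toStructure := inferInstance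
      fun_equiv := fun x y h => s.2 _ x y h
      rel_equiv := fun {_ r} => isEmptyElim r }
  { carrier := Quotient s.1
    nonempty := ⟨⟦Classical.arbitrary A⟧⟩
    sat := fun p q h v => by
      have hv : v = fun i => (⟦(v i).out⟧ : Quotient s.1) := funext fun i => (Quotient.out_eq _).symm
      rw [hv, Term.realize_quotient_mk', Term.realize_quotient_mk']
      exact congrArg _ (h _) }

/-- The canonical projection onto a quotient. -/
def VarFin.proj [σ.IsAlgebraic] [Finite A] [Nonempty A] (s : Congr σ A) (a : A) :
    (VarFin.quotient s).carrier :=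
  (⟦a⟧ : Quotient s.1)

theorem VarFin.funMap_proj [σ.IsAlgebraic] [Finite A] [Nonempty A] (s : Congr σ A) {n : ℕ}
    (f : σ.Functions n) (x : Fin n → A) :
    funMap f (fun i => VarFin.proj s (x i)) = VarFin.proj s (funMap f x) :=
  letI : σ.Prestructure s.1 :=
    { toStructure := inferInstance
      fun_equiv := fun x y h => s.2 _ x y h
      rel_equiv := fun {_ r} => isEmptyElim r }
  funMap_quotient_mk' (L := σ) s.1 f x

end Framework

/-! ### Algebras with all elements named: reduction to the congruence lattice -/

section Named

/-- An algebra in which every element is named by a nullary operation. -/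
class Named (σ : FirstOrder.Language.{0, 0}) (A : Type) [σ.Structure A] where
  name : A → σ.Functions 0
  funMap_name : ∀ (a : A) (v : Fin 0 → A), funMap (name a) v = a

variable {σ : FirstOrder.Language.{0, 0}} {A : Type} [σ.Structure A] [Named σ A]

/-- The element of `B` with the same name as `a`. -/
def VarFin.const (B : VarFin σ A) (a : A) : B.carrier :=
  funMap (Named.name (σ := σ) a) Fin.elim0

theorem VarFin.funMap_name (B : VarFin σ A) (a : A) (v : Fin 0 → B.carrier) :
    funMap (Named.name (σ := σ) a) v = B.const a :=
  congrArg _ (Subsingleton.elim _ _)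

variable (σ) in
/-- The closed term naming `a`. -/
def nameTerm (a : A) : σ.Term ℕ := .func (Named.name a) Fin.elim0

theorem realize_nameTerm_self (a : A) (v : ℕ → A) : (nameTerm σ a).realize v = a :=
  Named.funMap_name _ _

theorem VarFin.realize_nameTerm (B : VarFin σ A) (a : A) (v : ℕ → B.carrier) :
    (nameTerm σ a).realize v = B.const a :=
  B.funMap_name _ _

/-- The operation table of `A` consists of identities between closed terms, so it holds in `B`;
hence `B.const` is a homomorphism. -/
theorem VarFin.funMap_const (B : VarFin σ A) {n : ℕ} (f : σ.Functions n) (x : Fin n → A) :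
    funMap f (fun i => B.const (x i)) = B.const (funMap f x) := by
  obtain ⟨b⟩ := B.nonempty
  have h := B.sat (.func f fun i => nameTerm σ (x i)) (nameTerm σ (funMap f x))
    (fun v => by simp [Term.realize, realize_nameTerm_self]) (fun _ => b)
  simpa [Term.realize, VarFin.realize_nameTerm] using h

/-- The elements with equal interpretation in `B` of their names. -/
def VarFin.ker (B : VarFin σ A) : Congr σ A :=
  ⟨Setoid.ker B.const, fun f x y h => by
    change B.const _ = B.const _
    rw [← B.funMap_const, ← B.funMap_const]
    exact congrArg _ (funext h)⟩

theorem VarFin.map_const {B C : VarFin σ A} (g : B.carrier →[σ] C.carrier) (a : A) :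
    g (B.const a) = C.const a :=
  (g.map_fun _ _).trans (C.funMap_name _ _)

theorem VarFin.ker_le_of_le {B C : VarFin σ A} (h : B ≤ C) : B.ker ≤ C.ker := by
  obtain ⟨g⟩ := h
  intro a a' (haa : B.const a = B.const a')
  change C.const a = C.const a'
  rw [← map_const g, ← map_const g, haa]

theorem VarFin.ker_quotient [σ.IsAlgebraic] [Finite A] [Nonempty A] (s : Congr σ A) :
    (VarFin.quotient s).ker = s := by
  have h : ∀ a, (VarFin.quotient s).const a = VarFin.proj s a := fun a => by
    have := VarFin.funMap_proj s (Named.name (σ := σ) a) Fin.elim0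
    rw [Named.funMap_name] at this
    exact ((VarFin.quotient s).funMap_name a _).symm.trans this
  refine Subtype.ext (Setoid.ext fun a b => ?_)
  change (VarFin.quotient s).const a = (VarFin.quotient s).const b ↔ _
  rw [h, h]
  exact Quotient.eq

/-- If every finite member of the variety retracts onto the subalgebra of named elements, then
the homomorphism lattice is the congruence lattice. -/
theorem nonempty_homLattice_orderIso_congr [σ.IsAlgebraic] [Finite A] [Nonempty A]
    (retract : ∀ B : VarFin σ A, ∃ r : B.carrier → A, ∀ {n : ℕ} (f : σ.Functions n)
      (x : Fin n → B.carrier), B.const (r (funMap f x)) = B.const (funMap f fun i => r (x i))) :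
    Nonempty (HomLattice σ A ≃o Congr σ A) := by
  refine nonempty_homLattice_orderIso VarFin.ker (fun B C => ⟨VarFin.ker_le_of_le, fun h => ?_⟩)
    fun s => ⟨_, VarFin.ker_quotient s⟩
  -- The map `C.const ∘ r` is a homomorphism: `hr` gives the required equations in `B`, and `h`
  -- carries equations between names from `B` to `C`.
  obtain ⟨r, hr⟩ := retract B
  refine ⟨⟨fun b => C.const (r b), fun f x => ?_, fun r => isEmptyElim r⟩⟩
  exact (h (hr f x)).trans (C.funMap_const f _).symm

end Named

/-! ### Lower sets of finite forests -/

section Forest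

variable {P : Type}

open Classical in
/-- The map with value `v` at `p` and `false` elsewhere. -/
noncomputable def spike (p : P) (v : Bool) : P → Bool := Function.update (fun _ => false) p v

@[simp]
theorem spike_self (p : P) (v : Bool) : spike p v p = v := by simp [spike]

theorem spike_of_ne {p q : P} (h : q ≠ p) (v : Bool) : spike p v q = false := by simp [spike, h]

@[simp]
theorem spike_false (p : P) : spike p false = fun _ => false := by simp [spike]

variable [PartialOrder P]

/-- Operation symbols of the algebra `P → Bool` associated with an ordered set `P`. -/
inductive ForestOp (P : Type) [PartialOrder P] : ℕ → Type
  | const (a : P → Bool) : ForestOp P 0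
  | move (p q : P) (h : q ≤ p) : ForestOp P 1
  | replace (p : P) : ForestOp P 2

variable (P) in
/-- The signature with operation symbols `ForestOp P`. -/
def forestSig : FirstOrder.Language.{0, 0} := ⟨ForestOp P, fun _ => Empty⟩

instance : (forestSig P).IsAlgebraic := fun _ => inferInstanceAs (IsEmpty Empty)

open Classical in
/-- `const a` names `a`, `move p q` puts the coordinate at `p` into position `q` and erases the
other coordinates, `replace p` takes the coordinate at `p` from its second argument. -/
noncomputable instance : (forestSig P).Structure (P → Bool) where
  funMap {n} (f : ForestOp P n) := match n, f with
    | _, .const a => fun _ => a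
    | _, .move p q _ => fun v => spike q (v 0 p)
    | _, .replace p => fun v => Function.update (v 0) p (v 1 p)
  RelMap {_} (r : Empty) := r.elim

instance : Named (forestSig P) (P → Bool) where
  name a := ForestOp.const a
  funMap_name _ _ := rfl

/-- `ForestOp.move` as a function symbol. -/
def moveSymb (p q : P) (h : q ≤ p) : (forestSig P).Functions 1 := ForestOp.move p q h

/-- `ForestOp.replace` as a function symbol. -/
def replaceSymb (p : P) : (forestSig P).Functions 2 := ForestOp.replace p

theorem funMap_moveSymb (p q : P) (h : q ≤ p) (v : Fin 1 → P → Bool) :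
    funMap (moveSymb p q h) v = spike q (v 0 p) := rfl

open Classical in
theorem funMap_replaceSymb (p : P) (v : Fin 2 → P → Bool) :
    funMap (replaceSymb p) v = Function.update (v 0) p (v 1 p) := rfl

theorem Congr.spike_mono {s : Congr (forestSig P) (P → Bool)} {p q : P} (h : q ≤ p)
    {a b : P → Bool} (hab : s.1 a b) : s.1 (spike q (a p)) (spike q (b p)) :=
  s.2 (moveSymb p q h) ![a] ![b] (by simpa using hab)

/-- The coordinates that are not seen by a congruence. -/
def Congr.collapsed (s : Congr (forestSig P) (P → Bool)) : LowerSet P where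
  carrier := {p | s.1 (spike p true) (spike p false)}
  -- `move p q` takes the collapsed pair at `p` to the corresponding pair at `q`; this is where `q ≤
  -- p` enters.
  lower' p q h hp := by simpa using Congr.spike_mono h hp

theorem Congr.mem_collapsed {s : Congr (forestSig P) (P → Bool)} {p : P} :
    p ∈ s.collapsed ↔ s.1 (spike p true) (spike p false) := Iff.rfl

open Classical in
-- The collapsed coordinates can be changed one at a time by `replace`, and `P` is finite.
theorem Congr.rel_of_forall_eq [Finite P] {s : Congr (forestSig P) (P → Bool)} {a b : P → Bool}
    (h : ∀ p, p ∉ s.collapsed → a p = b p) : s.1 a b := by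
  have step : ∀ (p) (_ : p ∈ s.collapsed) (a : P → Bool) (u v : Bool),
      s.1 (Function.update a p u) (Function.update a p v) := by
    intro p hp a u v
    have huv : s.1 (spike p u) (spike p v) := by
      have h1 := Congr.mem_collapsed.1 hp
      rcases u <;> rcases v
      · exact s.1.refl _
      · exact s.1.symm h1
      · exact h1
      · exact s.1.refl _
    have := s.2 (replaceSymb p) ![a, spike p u] ![a, spike p v] (fun i => by
      fin_cases i
      · exact s.1.refl _
      · exact huv)
    simpa [funMap_replaceSymb] using this
  have key : ∀ (T : Finset P), (∀ p ∈ T, p ∈ s.collapsed) → ∀ a b : P → Bool,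
      (∀ p, p ∉ T → a p = b p) → s.1 a b := by
    intro T
    induction T using Finset.induction_on with
    | empty =>
      intro _ a b hab
      rw [show a = b from funext fun p => hab p (by simp)]
    | insert p T _ ih =>
      intro hT a b hab
      refine s.1.trans (b := Function.update a p (b p)) ?_ ?_
      · simpa using step p (hT p (by simp)) a (a p) (b p)
      · refine ih (fun q hq => hT q (by simp [hq])) _ _ fun q hq => ?_
        by_cases hqp : q = p
        · subst hqp; simp
        · simpa [hqp] using hab q (by simp [hq, hqp])
  have := Fintype.ofFinite P
  refine key (Finset.univ.filter (· ∈ s.collapsed)) (by simp) a b fun p hp => h p (by simpa using hp)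

/-- The congruence that ignores the coordinates in a lower set. -/
def LowerSet.toCongr (D : LowerSet P) : Congr (forestSig P) (P → Bool) where
  val :=
    { r := fun a b => ∀ p, p ∉ D → a p = b p
      iseqv := ⟨fun _ _ _ => rfl, fun h p hp => (h p hp).symm,
        fun h h' p hp => (h p hp).trans (h' p hp)⟩ }
  property {n} f x y h := by
    change ForestOp P n at f
    cases f with
    | const a => exact fun _ _ => rfl
    | move p q hqp =>
      intro i hi
      change spike q (x 0 p) i = spike q (y 0 p) i
      by_cases hiq : i = q
      · subst hiq
        simpa using h 0 p fun hp => hi (D.lower hqp hp)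
      · simp [spike_of_ne hiq]
    | replace p =>
      intro i hi
      classical
      change Function.update (x 0) p (x 1 p) i = Function.update (y 0) p (y 1 p) i
      by_cases hip : i = p
      · subst hip
        simpa using h 1 i hi
      · simpa [hip] using h 0 i hi

/-- If related `a` and `b` differ at `p`, then `move p p` isolates this difference and shows `p` to
be collapsed. So a congruence is recovered from its collapsed coordinates. -/
theorem nonempty_congr_orderIso_lowerSet [Finite P] :
    Nonempty (Congr (forestSig P) (P → Bool) ≃o LowerSet P) := by
  let e : Congr (forestSig P) (P → Bool) ↪o LowerSet P :=
    OrderEmbedding.ofMapLEIff Congr.collapsed fun s t => by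
      refine ⟨fun h a b hab => ?_, fun h p hp => h hp⟩
      refine Congr.rel_of_forall_eq fun p hp => ?_
      by_contra hne
      refine hp (h ?_)
      have hs := Congr.spike_mono (le_refl p) hab
      change s.1 _ _
      rcases ha : a p <;> rcases hb : b p <;> simp only [ha, hb] at hs hne
      · exact absurd trivial hne
      · exact s.1.symm hs
      · exact hs
      · exact absurd trivial hne
  refine ⟨RelIso.ofSurjective e fun D => ⟨LowerSet.toCongr D, SetLike.ext fun p => ?_⟩⟩
  constructor
  · intro h
    by_contra hp
    have := h p hp
    simp at this
  · intro hp q hq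
    have : q ≠ p := fun h => hq (h ▸ hp)
    rw [spike_of_ne this, spike_of_ne this]

section Retract

variable (B : VarFin (forestSig P) (P → Bool))

/-- The operation `move p q` of a member of the variety. -/
def VarFin.move {p q : P} (h : q ≤ p) (x : B.carrier) : B.carrier := funMap (moveSymb p q h) ![x]

/-- The operation `replace p` of a member of the variety. -/
def VarFin.replace (p : P) (x y : B.carrier) : B.carrier := funMap (replaceSymb p) ![x, y]

theorem VarFin.move_const {p q : P} (h : q ≤ p) (a : P → Bool) :
    B.move h (B.const a) = B.const (spike q (a p)) := by
  rw [← funMap_moveSymb p q h fun _ => a, ← B.funMap_const]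
  exact congrArg _ (funext fun i => by fin_cases i; rfl)

theorem VarFin.move_move {p q m : P} (h : q ≤ p) (h' : m ≤ q) (x : B.carrier) :
    B.move h' (B.move h x) = B.move (h'.trans h) x := by
  have := B.sat ((moveSymb q m h').apply₁ ((moveSymb p q h).apply₁ (.var 0)))
    ((moveSymb p m (h'.trans h)).apply₁ (.var 0))
    (fun v => by simp [Term.realize_functions_apply₁, funMap_moveSymb]) (fun _ => x)
  simpa [Term.realize_functions_apply₁, VarFin.move] using this

theorem VarFin.move_move_of_ne {p q q' m : P} (h : q ≤ p) (h' : m ≤ q') (hq : q' ≠ q)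
    (x : B.carrier) : B.move h' (B.move h x) = B.const fun _ => false := by
  have := B.sat ((moveSymb q' m h').apply₁ ((moveSymb p q h).apply₁ (.var 0)))
    (nameTerm (forestSig P) fun _ : P => false)
    (fun v => by simp [Term.realize_functions_apply₁, funMap_moveSymb, realize_nameTerm_self,
      spike_of_ne hq]) (fun _ => x)
  simpa [Term.realize_functions_apply₁, VarFin.realize_nameTerm, VarFin.move] using this

theorem VarFin.move_replace {p m : P} (h : m ≤ p) (x y : B.carrier) :
    B.move h (B.replace p x y) = B.move h y := by
  have := B.sat ((moveSymb p m h).apply₁ ((replaceSymb p).apply₂ (.var 0) (.var 1)))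
    ((moveSymb p m h).apply₁ (.var 1))
    (fun v => by simp [Term.realize_functions_apply₁, Term.realize_functions_apply₂,
      funMap_moveSymb, funMap_replaceSymb]) (fun i => if i = 0 then x else y)
  simpa [Term.realize_functions_apply₁, Term.realize_functions_apply₂, VarFin.move,
    VarFin.replace] using this

theorem VarFin.move_replace_of_ne {p q m : P} (h : m ≤ q) (hq : q ≠ p) (x y : B.carrier) :
    B.move h (B.replace p x y) = B.move h x := by
  have := B.sat ((moveSymb q m h).apply₁ ((replaceSymb p).apply₂ (.var 0) (.var 1)))
    ((moveSymb q m h).apply₁ (.var 0))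
    (fun v => by simp [Term.realize_functions_apply₁, Term.realize_functions_apply₂,
      funMap_moveSymb, funMap_replaceSymb, hq]) (fun i => if i = 0 then x else y)
  simpa [Term.realize_functions_apply₁, Term.realize_functions_apply₂, VarFin.move,
    VarFin.replace] using this

open Classical in
/-- The retraction onto the named elements reads the coordinate at `p` off in the least coordinate
below `p` that is not collapsed. -/
noncomputable def VarFin.readOff (x : B.carrier) (p : P) : Bool :=
  decide (∃ (m : P) (h : m ≤ p), IsLeast {q | q ≤ p ∧ q ∉ B.ker.collapsed} m ∧
    B.move h x = B.const (spike m true))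

variable {B}

open Classical in
theorem VarFin.readOff_eq {x : B.carrier} {p m : P} (h : m ≤ p)
    (hm : IsLeast {q | q ≤ p ∧ q ∉ B.ker.collapsed} m) :
    B.readOff x p = true ↔ B.move h x = B.const (spike m true) := by
  refine decide_eq_true_iff.trans ⟨?_, fun h' => ⟨m, h, hm, h'⟩⟩
  rintro ⟨m', h', hm', e⟩
  obtain rfl := hm'.unique hm
  exact e

theorem VarFin.const_spike_ne {m : P} (hm : m ∉ B.ker.collapsed) :
    B.const (fun _ => false) ≠ B.const (spike m true) := fun h => hm <| by
  refine Congr.mem_collapsed.2 ?_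
  rw [spike_false]
  exact h.symm

theorem exists_isLeast_of_chain [Finite P]
    (chain : ∀ p q r : P, q ≤ p → r ≤ p → q ≤ r ∨ r ≤ q) (D : LowerSet P) {p : P} (hp : p ∉ D) :
    ∃ m, IsLeast {q | q ≤ p ∧ q ∉ D} m := by
  obtain ⟨m, hm⟩ := (Set.toFinite {q | q ≤ p ∧ q ∉ D}).exists_minimal ⟨p, le_refl p, hp⟩
  exact ⟨m, hm.1, fun q hq => (chain p m q hm.1.1 hq.1).elim id fun h => hm.2 hq h⟩

/-- Only uncollapsed coordinates `p` have to be compared. The delicate operation is `move p' p`: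
reading its result at `p` must agree with reading the argument at `p'`. A test made at `p'` itself
could be strictly stronger than one made further down, so both are made at one common place, the
least uncollapsed coordinate. -/
theorem VarFin.exists_retract_forest [Finite P]
    (chain : ∀ p q r : P, q ≤ p → r ≤ p → q ≤ r ∨ r ≤ q)
    (B : VarFin (forestSig P) (P → Bool)) : ∃ r : B.carrier → (P → Bool), ∀ {n : ℕ}
      (f : (forestSig P).Functions n) (x : Fin n → B.carrier),
      B.const (r (funMap f x)) = B.const (funMap f fun i => r (x i)) := by
  refine ⟨B.readOff, fun {n} f x => ?_⟩
  refine Congr.rel_of_forall_eq (s := B.ker) fun p hp => ?_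
  obtain ⟨m, hm⟩ := exists_isLeast_of_chain chain _ hp
  have hmp : m ≤ p := hm.1.1
  have hne := VarFin.const_spike_ne hm.1.2
  rw [Bool.eq_iff_iff, VarFin.readOff_eq hmp hm]
  change ForestOp P n at f
  cases f with
  | const a =>
    change B.move hmp (funMap (Named.name (σ := forestSig P) a) x) = _ ↔ a p = true
    rw [B.funMap_name, B.move_const]
    cases a p
    · simpa using hne
    · simp
  | move p' q h =>
    change B.move hmp (funMap (moveSymb p' q h) x) = _ ↔ spike q (B.readOff (x 0) p') p = true
    have hx : funMap (moveSymb p' q h) x = B.move h (x 0) :=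
      congrArg _ (funext fun i => by fin_cases i; rfl)
    rw [hx]
    by_cases hq : p = q
    · subst hq
      rw [B.move_move, spike_self, VarFin.readOff_eq (hmp.trans h)]
      -- Everything below `p'` is comparable with `p`, so the least uncollapsed element below `p` is
      -- also the least below `p'`.
      refine ⟨⟨hmp.trans h, hm.1.2⟩, fun q hq => ?_⟩
      rcases chain p' p q h hq.1 with h1 | h1
      · exact hmp.trans h1
      · exact hm.2 ⟨h1, hq.2⟩
    · rw [B.move_move_of_ne _ _ hq, spike_of_ne hq]
      simpa using hne
  | replace q =>
    classical
    change B.move hmp (funMap (replaceSymb q) x) = _ ↔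
      Function.update (B.readOff (x 0)) q (B.readOff (x 1) q) p = true
    have hx : funMap (replaceSymb q) x = B.replace q (x 0) (x 1) :=
      congrArg _ (funext fun i => by fin_cases i <;> rfl)
    rw [hx]
    by_cases hq : p = q
    · subst hq
      rw [B.move_replace, Function.update_self, VarFin.readOff_eq hmp hm]
    · rw [B.move_replace_of_ne _ hq, Function.update_of_ne hq, VarFin.readOff_eq hmp hm]

end Retract

theorem isHomLattice_lowerSet [Finite P]
    (chain : ∀ p q r : P, q ≤ p → r ≤ p → q ≤ r ∨ r ≤ q) : IsHomLattice (LowerSet P) := by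
  obtain ⟨e⟩ := nonempty_congr_orderIso_lowerSet (P := P)
  obtain ⟨e'⟩ := nonempty_homLattice_orderIso_congr (σ := forestSig P) (A := P → Bool)
    (VarFin.exists_retract_forest chain)
  exact ⟨forestSig P, inferInstance, P → Bool, inferInstance, inferInstance, inferInstance,
    ⟨e'.trans e⟩⟩

/-- A finite lattice `K` is represented if it has a join-dense family `p` of elements, each with a
largest element `κ p` not above it, such that the members of the family below any given member
form a chain. -/
theorem isHomLattice_of_splitting {K : Type} [Lattice K] [BoundedOrder K] [Finite K] (J : K → Prop)
    (κ : K → K) (hκ : ∀ p, J p → ∀ a, a ≤ κ p ↔ ¬ p ≤ a)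
    (hJ : ∀ a b : K, (∀ p, J p → p ≤ a → p ≤ b) → a ≤ b)
    (chain : ∀ p q r : K, J p → J q → J r → q ≤ p → r ≤ p → q ≤ r ∨ r ≤ q) :
    IsHomLattice K := by
  refine (isHomLattice_lowerSet (P := {p // J p}) fun p q r =>
    chain p q r p.2 q.2 r.2).of_orderIso (OrderIso.symm ?_)
  let e : K ↪o LowerSet {p // J p} :=
    OrderEmbedding.ofMapLEIff
      (fun a => ⟨{p | p.1 ≤ a}, fun _ _ h h' => le_trans h h'⟩) fun a b =>
        ⟨fun h => hJ a b fun p hp hpa => h (show (⟨p, hp⟩ : {p // J p}).1 ≤ a from hpa),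
          fun h p hp => le_trans hp h⟩
  refine RelIso.ofSurjective e fun D => ?_
  classical
  have := Fintype.ofFinite K
  refine ⟨(Finset.univ.filter (· ∈ D)).sup Subtype.val, SetLike.ext fun p => ?_⟩
  change p.1 ≤ _ ↔ p ∈ D
  constructor
  · intro h
    by_contra hp
    -- Join-primeness: if `p ∉ D`, no member of `D` is above `p`, so all of them, and hence their
    -- join, are below `κ p`.
    refine (hκ p p.2 _).1 (Finset.sup_le fun q hq => (hκ p p.2 _).2 fun hpq => hp ?_) h
    exact D.lower hpq (by simpa using hq)
  · exact fun hp => Finset.le_sup (f := Subtype.val) (by simpa using hp)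

end Forest

/-! ### Permutations of order dividing six -/

section Cyclic

/-- The operation symbols of a monounary algebra. -/
inductive UnaryOp : ℕ → Type
  | next : UnaryOp 1

/-- The signature of monounary algebras. -/
def unarySig : FirstOrder.Language.{0, 0} := ⟨UnaryOp, fun _ => Empty⟩

instance : unarySig.IsAlgebraic := fun _ => inferInstanceAs (IsEmpty Empty)

/-- The operation symbol of a monounary algebra. -/
def nextSymb : unarySig.Functions 1 := UnaryOp.next

/-- A map as a monounary algebra. -/
@[reducible]
def unaryStructure {D : Type} (g : D → D) : unarySig.Structure D where
  funMap {n} (f : UnaryOp n) := match n, f with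
    | _, .next => fun v => g (v 0)
  RelMap {_} (r : Empty) := r.elim

/-- The operation of a monounary algebra. -/
def next {D : Type} [unarySig.Structure D] (x : D) : D := funMap nextSymb ![x]

theorem funMap_unary {D : Type} [unarySig.Structure D] (v : Fin 1 → D) :
    funMap nextSymb v = next (v 0) :=
  congrArg _ (funext fun i => by fin_cases i; rfl)

theorem exists_realize_eq_iterate (t : unarySig.Term ℕ) :
    ∃ k i : ℕ, ∀ (D : Type) [unarySig.Structure D] (v : ℕ → D), t.realize v = next^[k] (v i) := by
  induction t with
  | var i => exact ⟨0, i, fun _ _ _ => rfl⟩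
  | @func n f ts ih =>
    change UnaryOp n at f
    cases f
    obtain ⟨k, i, h⟩ := ih 0
    refine ⟨k + 1, i, fun D _ v => ?_⟩
    rw [Function.iterate_succ_apply', ← h D v]
    exact funMap_unary _

/-- The six-element cycle. -/
instance : unarySig.Structure (ZMod 6) := unaryStructure (· + 1)

theorem iterate_next_zmod (k : ℕ) (x : ZMod 6) : next^[k] x = x + k := by
  induction k with
  | zero => simp
  | succ k ih =>
    rw [Function.iterate_succ_apply', ih]
    change x + k + 1 = _
    push_cast
    ring

/-- The identity `next^[6] x = x` axiomatises the variety of the 6-cycle: two terms agreeing on the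
cycle involve the same variable and iteration counts congruent modulo 6. -/
theorem realize_eq_of_iterate_six {D : Type} [unarySig.Structure D]
    (hD : ∀ x : D, next^[6] x = x) (s t : unarySig.Term ℕ)
    (h : ∀ v : ℕ → ZMod 6, s.realize v = t.realize v) (v : ℕ → D) :
    s.realize v = t.realize v := by
  obtain ⟨k, i, hs⟩ := exists_realize_eq_iterate s
  obtain ⟨l, j, ht⟩ := exists_realize_eq_iterate t
  have hv : ∀ v : ℕ → ZMod 6, v i + k = v j + l := fun v => by
    rw [← iterate_next_zmod, ← iterate_next_zmod, ← hs, ← ht, h]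
  have hij : i = j := by
    by_contra hij
    have h0 := hv fun _ => 0
    have h1 := hv fun m => if m = i then 1 else 0
    simp only [if_pos, if_neg (Ne.symm hij)] at h0 h1
    rw [← h0, zero_add] at h1
    exact absurd (add_eq_right.1 h1) (by decide)
  subst hij
  have hkl : k % 6 = l % 6 := (ZMod.natCast_eq_natCast_iff' k l 6).1 (by simpa using hv fun _ => 0)
  have hp : Function.IsPeriodicPt next 6 (v i) := hD _
  rw [hs, ht, ← hp.iterate_mod_apply k, ← hp.iterate_mod_apply l, hkl]

theorem VarFin.iterate_six (B : VarFin unarySig (ZMod 6)) (x : B.carrier) : next^[6] x = x := by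
  have := B.sat (nextSymb.apply₁ (nextSymb.apply₁ (nextSymb.apply₁ (nextSymb.apply₁
    (nextSymb.apply₁ (nextSymb.apply₁ (.var 0))))))) (.var 0) (fun v => by
      simp only [Term.realize_functions_apply₁, Term.realize_var]
      exact (iterate_next_zmod 6 (v 0)).trans (by rw [show ((6 : ℕ) : ZMod 6) = 0 from rfl, add_zero]))
    (fun _ => x)
  simp only [Term.realize_functions_apply₁, Term.realize_var] at this
  exact this

/-- A permutation whose sixth power is the identity, as a member of the variety. -/
def VarFin.ofMap {D : Type} [Finite D] [Nonempty D] (g : D → D) (hg : ∀ x, g^[6] x = x) :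
    VarFin unarySig (ZMod 6) :=
  letI := unaryStructure g
  { carrier := D
    sat := realize_eq_of_iterate_six hg }

/-- `B` has a point that is fixed by the `d`-th iterate of its operation. -/
def VarFin.HasPeriod (B : VarFin unarySig (ZMod 6)) (d : ℕ) : Prop :=
  ∃ x : B.carrier, next^[d] x = x

theorem VarFin.hasPeriod_ofMap {D : Type} [Finite D] [Nonempty D] (g : D → D)
    (hg : ∀ x, g^[6] x = x) (d : ℕ) : (VarFin.ofMap g hg).HasPeriod d ↔ ∃ x, g^[d] x = x :=
  Iff.rfl

theorem VarFin.HasPeriod.of_dvd {B : VarFin unarySig (ZMod 6)} {d e : ℕ} (h : B.HasPeriod d)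
    (hde : d ∣ e) : B.HasPeriod e := by
  obtain ⟨x, hx⟩ := h
  exact ⟨x, Function.IsPeriodicPt.trans_dvd hx hde⟩

theorem VarFin.HasPeriod.of_le {B C : VarFin unarySig (ZMod 6)} (h : B ≤ C) {d : ℕ}
    (hB : B.HasPeriod d) : C.HasPeriod d := by
  obtain ⟨g⟩ := h
  obtain ⟨x, hx⟩ := hB
  have hg : Function.Semiconj g next next := fun x => (g.map_fun _ _).trans (funMap_unary _)
  exact ⟨g x, by rw [← (hg.iterate_right d).eq, hx]⟩

/-- Two points are related when they lie on the same cycle. -/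
def VarFin.cycleSetoid (B : VarFin unarySig (ZMod 6)) : Setoid B.carrier where
  r x y := ∃ k : ℕ, next^[k] x = y
  iseqv :=
    { refl := fun x => ⟨0, rfl⟩
      symm := by
        rintro x _ ⟨k, rfl⟩
        refine ⟨5 * k, ?_⟩
        have : Function.IsPeriodicPt next 6 x := B.iterate_six x
        rw [← Function.iterate_add_apply, show 5 * k + k = 6 * k by ring]
        exact this.mul_const k
      trans := by
        rintro x _ _ ⟨k, rfl⟩ ⟨l, rfl⟩
        exact ⟨l + k, Function.iterate_add_apply _ _ _ _⟩ }

/-- A cycle maps to `C` as soon as its length is a period of some point of `C`. A representative is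
chosen on every cycle, sent to such a point, and the map is extended along iterates. -/
theorem VarFin.le_of_forall_exists {B C : VarFin unarySig (ZMod 6)}
    (h : ∀ x : B.carrier, C.HasPeriod (Function.minimalPeriod next x)) : B ≤ C := by
  choose y hy using h
  let rep : B.carrier → B.carrier := fun x => (Quotient.mk B.cycleSetoid x).out
  have hrep : ∀ x, ∃ k : ℕ, next^[k] (rep x) = x := fun x =>
    Quotient.exact (s := B.cycleSetoid) (Quotient.out_eq _)
  have hnext : ∀ x, rep (next x) = rep x := fun x =>
    congrArg Quotient.out (Quotient.sound (s := B.cycleSetoid)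
      (B.cycleSetoid.symm ⟨1, rfl⟩))
  choose k hk using hrep
  -- Well-definedness: coincidences among the iterates of `x` persist for `y x`, which has the
  -- minimal period of `x` as a period.
  have key : ∀ (x : B.carrier) (i j : ℕ), next^[i] x = next^[j] x →
      next^[i] (y x) = next^[j] (y x) := by
    intro x i j hij
    have hx : 0 < Function.minimalPeriod next x :=
      Function.IsPeriodicPt.minimalPeriod_pos (n := 6) (by norm_num) (B.iterate_six x)
    have hp : Function.IsPeriodicPt next (Function.minimalPeriod next x) (y x) := hy x
    rw [← hp.iterate_mod_apply i, ← hp.iterate_mod_apply j]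
    rw [← Function.iterate_mod_minimalPeriod_eq (n := i),
      ← Function.iterate_mod_minimalPeriod_eq (n := j)] at hij
    rw [Function.iterate_injOn_Iio_minimalPeriod (Nat.mod_lt _ hx) (Nat.mod_lt _ hx) hij]
  refine ⟨⟨fun x => next^[k x] (y (rep x)), fun {n} f v => ?_, fun r => isEmptyElim r⟩⟩
  change UnaryOp n at f
  cases f
  refine Eq.trans ?_ (funMap_unary _).symm
  change next^[k (funMap nextSymb v)] (y (rep (funMap nextSymb v))) =
    next (next^[k (v 0)] (y (rep (v 0))))
  rw [funMap_unary, hnext, ← Function.iterate_succ_apply' next]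
  refine key _ _ _ ?_
  rw [Function.iterate_succ_apply', hk, ← hnext, hk]

/-- Cycle lengths divide 6, and period 6 is always available in the nonempty target. -/
theorem VarFin.le_iff_hasPeriod {B C : VarFin unarySig (ZMod 6)} :
    B ≤ C ↔ (B.HasPeriod 1 → C.HasPeriod 1) ∧ (B.HasPeriod 2 → C.HasPeriod 2) ∧
      (B.HasPeriod 3 → C.HasPeriod 3) := by
  refine ⟨fun h => ⟨.of_le h, .of_le h, .of_le h⟩, fun ⟨h1, h2, h3⟩ =>
    VarFin.le_of_forall_exists fun x => ?_⟩
  have hx : B.HasPeriod (Function.minimalPeriod next x) :=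
    ⟨x, Function.isPeriodicPt_minimalPeriod _ _⟩
  have hd : Function.minimalPeriod next x ∈ Nat.divisors 6 :=
    Nat.mem_divisors.2 ⟨Function.IsPeriodicPt.minimalPeriod_dvd (B.iterate_six x), by norm_num⟩
  rw [show Nat.divisors 6 = {1, 2, 3, 6} from by decide] at hd
  simp only [Finset.mem_insert, Finset.mem_singleton] at hd
  rcases hd with hd | hd | hd | hd <;> rw [hd] at hx ⊢
  · exact h1 hx
  · exact h2 hx
  · exact h3 hx
  · obtain ⟨c⟩ := C.nonempty
    exact ⟨c, C.iterate_six c⟩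

/-- The four-element Boolean lattice with a new top is represented by the six-element cycle. -/
theorem isHomLattice_of_square_top {K : Type} [Lattice K] [BoundedOrder K] (u v w : K)
    (cover : ∀ x : K, x = ⊥ ∨ x = ⊤ ∨ x = u ∨ x = v ∨ x = w) (huv : ¬ u ≤ v) (hvu : ¬ v ≤ u)
    (huw : u ≤ w) (hvw : v ≤ w) (hw : w ≠ ⊤) : IsHomLattice K := by
  classical
  refine ⟨unarySig, inferInstance, ZMod 6, inferInstance, inferInstance, inferInstance, ?_⟩
  have hu : ¬ u ≤ ⊥ := fun h => huv (h.trans bot_le)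
  have hv : ¬ v ≤ ⊥ := fun h => hvu (h.trans bot_le)
  have hwu : ¬ w ≤ u := fun h => hvu (hvw.trans h)
  have hwv : ¬ w ≤ v := fun h => huv (huw.trans h)
  have hwb : ¬ w ≤ ⊥ := fun h => hu (huw.trans h)
  have htw : ¬ ⊤ ≤ w := fun h => hw (top_le_iff.1 h)
  have htu : ¬ ⊤ ≤ u := fun h => htw (h.trans huw)
  have htv : ¬ ⊤ ≤ v := fun h => htw (h.trans hvw)
  have htb : (⊤ : K) ≠ ⊥ := fun h => htu (h.le.trans bot_le)
  refine nonempty_homLattice_orderIso (fun B =>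
    if B.HasPeriod 1 then ⊤ else if B.HasPeriod 2 then (if B.HasPeriod 3 then w else u)
      else if B.HasPeriod 3 then v else ⊥) (fun B C => ?_) fun x => ?_
  · have hB2 : B.HasPeriod 1 → B.HasPeriod 2 := fun h => h.of_dvd (by norm_num)
    have hB3 : B.HasPeriod 1 → B.HasPeriod 3 := fun h => h.of_dvd (by norm_num)
    have hC2 : C.HasPeriod 1 → C.HasPeriod 2 := fun h => h.of_dvd (by norm_num)
    have hC3 : C.HasPeriod 1 → C.HasPeriod 3 := fun h => h.of_dvd (by norm_num)
    rw [VarFin.le_iff_hasPeriod]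
    split_ifs <;> simp_all
  -- The witnesses are the 6-cycle, a fixed point, the 2-cycle, the 3-cycle and the disjoint union
  -- of the last two.
  · rcases cover x with rfl | rfl | rfl | rfl | rfl
    · refine ⟨.ofMap (D := ZMod 6) (· + 1) (by decide), ?_⟩
      simp only [VarFin.hasPeriod_ofMap]
      rw [if_neg (by decide), if_neg (by decide), if_neg (by decide)]
    · refine ⟨.ofMap (D := Unit) id (by decide), ?_⟩
      simp only [VarFin.hasPeriod_ofMap]
      rw [if_pos (by decide)]
    · refine ⟨.ofMap (D := ZMod 2) (· + 1) (by decide), ?_⟩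
      simp only [VarFin.hasPeriod_ofMap]
      rw [if_neg (by decide), if_pos (by decide), if_neg (by decide)]
    · refine ⟨.ofMap (D := ZMod 3) (· + 1) (by decide), ?_⟩
      simp only [VarFin.hasPeriod_ofMap]
      rw [if_neg (by decide), if_neg (by decide), if_pos (by decide)]
    · refine ⟨.ofMap (D := ZMod 2 ⊕ ZMod 3) (Sum.map (· + 1) (· + 1)) (by decide), ?_⟩
      simp only [VarFin.hasPeriod_ofMap]
      rw [if_neg (by decide), if_pos (by decide), if_pos (by decide)]

end Cyclic

/-! ### The bisemilattice S × L and the pentagon -/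

section Pentagon

instance : sig.IsAlgebraic := fun _ => inferInstanceAs (IsEmpty Empty)

instance : Finite S := Finite.of_injective (fun s : S => match s with | .x => false | .y => true) (by
  rintro ⟨⟩ ⟨⟩ h <;> first | rfl | cases h)

instance : Finite L := Finite.of_injective (fun s : L => match s with | .y => false | .z => true) (by
  rintro ⟨⟩ ⟨⟩ h <;> first | rfl | cases h)

instance : Nonempty (S × L) := ⟨(.x, .y)⟩

/-- The symbol naming an element of `S × L`. -/
def elementOp : S × L → Op 0
  | (.x, .y) => .zero
  | (.y, .y) => .a
  | (.x, .z) => .b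
  | (.y, .z) => .one

instance : Named sig (S × L) where
  name := elementOp
  funMap_name := by rintro ⟨⟨⟩, ⟨⟩⟩ v <;> rfl

/-- The operation symbol `∧`. -/
def wedgeSymb : sig.Functions 2 := Op.wedge

/-- The operation symbol `⊓`. -/
def sqcapSymb : sig.Functions 2 := Op.sqcap

theorem funMap_wedgeSymb (v : Fin 2 → S × L) :
    funMap wedgeSymb v = (S.meet (v 0).1 (v 1).1, L.wedge (v 0).2 (v 1).2) := rfl

theorem funMap_sqcapSymb (v : Fin 2 → S × L) :
    funMap sqcapSymb v = (S.meet (v 0).1 (v 1).1, L.sqcap (v 0).2 (v 1).2) := rfl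

/-- It suffices to check a statement about operation symbols on the constants and the two binary
operations. -/
theorem Op.forall_iff {motive : ∀ {n : ℕ}, sig.Functions n → Prop}
    (name : ∀ d : S × L, motive (Named.name (σ := sig) d)) (wedge : motive wedgeSymb)
    (sqcap : motive sqcapSymb) {n : ℕ} (f : sig.Functions n) : motive f := by
  change Op n at f
  cases f with
  | zero => exact name (.x, .y)
  | a => exact name (.y, .y)
  | b => exact name (.x, .z)
  | one => exact name (.y, .z)
  | wedge => exact wedge
  | sqcap => exact sqcap

theorem compatible_sig_iff (s : Setoid (S × L))
    (wedge : ∀ c c' d d', s c c' → s d d' →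
      s (S.meet c.1 d.1, L.wedge c.2 d.2) (S.meet c'.1 d'.1, L.wedge c'.2 d'.2))
    (sqcap : ∀ c c' d d', s c c' → s d d' →
      s (S.meet c.1 d.1, L.sqcap c.2 d.2) (S.meet c'.1 d'.1, L.sqcap c'.2 d'.2)) :
    Compatible sig s := fun {n} f => by
  refine Op.forall_iff (motive := fun {n} f => ∀ x y : Fin n → S × L, (∀ i, s (x i) (y i)) →
    s (funMap f x) (funMap f y)) (fun d x y _ => ?_) (fun x y h => ?_) (fun x y h => ?_) f
  · rw [Named.funMap_name, Named.funMap_name]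
  · exact wedge _ _ _ _ (h 0) (h 1)
  · exact sqcap _ _ _ _ (h 0) (h 1)

section

variable (s : Congr sig (S × L))

theorem Congr.wedge {s : Congr sig (S × L)} {c c' : S × L} (h : s.1 c c') (d : S × L) :
    s.1 (S.meet c.1 d.1, L.wedge c.2 d.2) (S.meet c'.1 d.1, L.wedge c'.2 d.2) :=
  s.2 wedgeSymb ![c, d] ![c', d] fun i => by
    fin_cases i
    · exact h
    · exact s.1.refl _

theorem Congr.sqcap {s : Congr sig (S × L)} {c c' : S × L} (h : s.1 c c') (d : S × L) :
    s.1 (S.meet c.1 d.1, L.sqcap c.2 d.2) (S.meet c'.1 d.1, L.sqcap c'.2 d.2) :=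
  s.2 sqcapSymb ![c, d] ![c', d] fun i => by
    fin_cases i
    · exact h
    · exact s.1.refl _

/-- A congruence of `S × L` is determined by the pairs `(0, b)`, `(a, 1)` and `(0, a)`. -/
theorem Congr.rel_iff (c d : S × L) :
    s.1 c d ↔ (c.1 ≠ d.1 → s.1 (.x, .y) (.y, .y)) ∧ (c.2 ≠ d.2 → s.1 (.x, .y) (.x, .z)) ∧
      (c.2 ≠ d.2 → c.1 = .y → d.1 = .y → s.1 (.y, .y) (.y, .z)) := by
  have hb1 : s.1 (.x, .y) (.y, .y) → s.1 (.x, .z) (.y, .z) := fun h => Congr.sqcap h (.y, .z)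
  constructor
  · intro h
    refine ⟨fun hne => ?_, fun hne => ?_, fun hne hc hd => ?_⟩
    -- `∧ a` remembers exactly the first coordinate; dually, `∧ b` below remembers exactly the
    -- second.
    · have := Congr.wedge h (.y, .y)
      rcases c with ⟨⟨⟩, ⟨⟩⟩ <;> rcases d with ⟨⟨⟩, ⟨⟩⟩ <;>
        first | exact this | exact s.1.symm this | exact absurd rfl hne
    · have := Congr.wedge h (.x, .z)
      rcases c with ⟨⟨⟩, ⟨⟩⟩ <;> rcases d with ⟨⟨⟩, ⟨⟩⟩ <;>
        first | exact this | exact s.1.symm this | exact absurd rfl hne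
    · rcases c with ⟨⟨⟩, ⟨⟩⟩ <;> rcases d with ⟨⟨⟩, ⟨⟩⟩ <;>
        first | exact h | exact s.1.symm h | exact absurd rfl hne | (simp at hc; done) | simp at hd
  · rintro ⟨hR, hP, hQ⟩
    rcases c with ⟨⟨⟩, ⟨⟩⟩ <;> rcases d with ⟨⟨⟩, ⟨⟩⟩ <;>
      simp only [ne_eq, reduceCtorEq, not_false_eq_true, not_true_eq_false, forall_const,
        false_imp_iff] at hR hP hQ <;>
      first
        | exact s.1.refl _
        | exact hP
        | exact s.1.symm hP
        | exact hR
        | exact s.1.symm hR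
        | exact hQ
        | exact s.1.symm hQ
        | exact hb1 hR
        | exact s.1.symm (hb1 hR)
        | exact s.1.trans hP (hb1 hR)
        | exact s.1.symm (s.1.trans hP (hb1 hR))
        | exact s.1.trans (s.1.symm hR) hP
        | exact s.1.trans (s.1.symm hP) hR

theorem Congr.zero_b_of_a_one (h : s.1 (.y, .y) (.y, .z)) : s.1 (.x, .y) (.x, .z) :=
  Congr.wedge h (.x, .z)

theorem Congr.a_one_of_zero (h : s.1 (.x, .y) (.x, .z)) (h' : s.1 (.x, .y) (.y, .y)) :
    s.1 (.y, .y) (.y, .z) :=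
  s.1.trans (s.1.symm h') (s.1.trans h (Congr.sqcap h' (.y, .z)))

theorem Congr.le_iff (t : Congr sig (S × L)) :
    s ≤ t ↔ (s.1 (.x, .y) (.x, .z) → t.1 (.x, .y) (.x, .z)) ∧
      (s.1 (.y, .y) (.y, .z) → t.1 (.y, .y) (.y, .z)) ∧
      (s.1 (.x, .y) (.y, .y) → t.1 (.x, .y) (.y, .y)) := by
  refine ⟨fun h => ⟨fun h' => h h', fun h' => h h', fun h' => h h'⟩, fun ⟨hP, hQ, hR⟩ c d h => ?_⟩
  obtain ⟨h1, h2, h3⟩ := (s.rel_iff c d).1 h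
  exact (t.rel_iff c d).2 ⟨fun h => hR (h1 h), fun h => hP (h2 h), fun h h' h'' => hQ (h3 h h' h'')⟩

end

/-- Representatives of the classes of the congruences of `S × L`. -/
def N5.rep : N5 → S × L → S × L
  | .bot, d => d
  | .p, (.x, _) => (.x, .y)
  | .p, d => d
  | .q, d => (d.1, .y)
  | .r, d => (.x, d.2)
  | .top, _ => (.x, .y)

/-- The congruences of `S × L`. -/
def N5.congr (k : N5) : Congr sig (S × L) :=
  ⟨Setoid.ker k.rep, compatible_sig_iff _ (fun c c' d d' h h' => by
    change k.rep _ = k.rep _ at h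
    change k.rep _ = k.rep _ at h'
    change k.rep _ = k.rep _
    rcases k <;> rcases c with ⟨⟨⟩, ⟨⟩⟩ <;> rcases c' with ⟨⟨⟩, ⟨⟩⟩ <;>
      first
        | (cases h; done)
        | (rcases d with ⟨⟨⟩, ⟨⟩⟩ <;> rcases d' with ⟨⟨⟩, ⟨⟩⟩ <;> first | rfl | cases h'))
    (fun c c' d d' h h' => by
    change k.rep _ = k.rep _ at h
    change k.rep _ = k.rep _ at h'
    change k.rep _ = k.rep _
    rcases k <;> rcases c with ⟨⟨⟩, ⟨⟩⟩ <;> rcases c' with ⟨⟨⟩, ⟨⟩⟩ <;>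
      first
        | (cases h; done)
        | (rcases d with ⟨⟨⟩, ⟨⟩⟩ <;> rcases d' with ⟨⟨⟩, ⟨⟩⟩ <;> first | rfl | cases h'))⟩

theorem N5.le_iff (u v : N5) : u ≤ v ↔ N5.join u v = v := Iff.rfl

/-- Identifying (a,1) identifies (0,b), and identifying both (0,b) and (0,a) identifies (a,1). The
five patterns that survive are those of the kernels of `N5.rep`. -/
theorem nonempty_congr_orderIso_N5 : Nonempty (Congr sig (S × L) ≃o N5) := by
  let e : N5 ↪o Congr sig (S × L) := OrderEmbedding.ofMapLEIff N5.congr fun k l => by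
    rw [Congr.le_iff, N5.le_iff]
    change (k.rep _ = k.rep _ → l.rep _ = l.rep _) ∧ (k.rep _ = k.rep _ → l.rep _ = l.rep _) ∧
      (k.rep _ = k.rep _ → l.rep _ = l.rep _) ↔ _
    rcases k <;> rcases l <;> simp [N5.rep, N5.join]
  refine ⟨(RelIso.ofSurjective e fun s => ?_).symm⟩
  have key : ∀ k : N5, (s.1 (.x, .y) (.x, .z) ↔ k.rep (.x, .y) = k.rep (.x, .z)) →
      (s.1 (.y, .y) (.y, .z) ↔ k.rep (.y, .y) = k.rep (.y, .z)) →
      (s.1 (.x, .y) (.y, .y) ↔ k.rep (.x, .y) = k.rep (.y, .y)) → ∃ k, e k = s := fun k h1 h2 h3 =>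
    ⟨k, le_antisymm ((Congr.le_iff _ _).2 ⟨h1.2, h2.2, h3.2⟩)
      ((Congr.le_iff _ _).2 ⟨h1.1, h2.1, h3.1⟩)⟩
  have hQP := s.zero_b_of_a_one
  have hPR := s.a_one_of_zero
  by_cases hP : s.1 (.x, .y) (.x, .z) <;> by_cases hR : s.1 (.x, .y) (.y, .y)
  · exact key .top (by simpa [N5.rep] using hP) (by simpa [N5.rep] using hPR hP hR)
      (by simpa [N5.rep] using hR)
  · by_cases hQ : s.1 (.y, .y) (.y, .z)
    · exact key .q (by simpa [N5.rep] using hP) (by simpa [N5.rep] using hQ)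
        (by simpa [N5.rep] using hR)
    · exact key .p (by simpa [N5.rep] using hP) (by simpa [N5.rep] using hQ)
        (by simpa [N5.rep] using hR)
  · exact key .r (by simpa [N5.rep] using hP) (by simpa [N5.rep] using mt hQP hP)
      (by simpa [N5.rep] using hR)
  · exact key .bot (by simpa [N5.rep] using hP) (by simpa [N5.rep] using mt hQP hP)
      (by simpa [N5.rep] using hR)

/-- A minimal `e` with `o < e ≤ t` works: for `x ≥ o` the meet `x ⊓ e` lies between `o` and `e`. -/
theorem exists_relative_atom {α : Type*} [SemilatticeInf α] [Finite α] {o t : α} (h : o < t) :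
    ∃ e, e ≤ t ∧ o < e ∧ ∀ x, o ≤ x → ¬ e ≤ x → x ⊓ e = o := by
  obtain ⟨e, he⟩ := (Set.toFinite {e | e ≤ t ∧ o < e}).exists_minimal ⟨t, le_refl t, h⟩
  refine ⟨e, he.1.1, he.1.2, fun x hox hex => ?_⟩
  by_contra hne
  exact hex ((he.2 ⟨inf_le_right.trans he.1.1,
    lt_of_le_of_ne (le_inf hox he.1.2.le) (Ne.symm hne)⟩ inf_le_right).trans inf_le_left)

section Retract

variable (B : VarFin sig (S × L))

/-- The operation `∧` of a member of the variety. -/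
def VarFin.wedge (x y : B.carrier) : B.carrier := funMap wedgeSymb ![x, y]

/-- The operation `⊓` of a member of the variety. -/
def VarFin.sqcap (x y : B.carrier) : B.carrier := funMap sqcapSymb ![x, y]

theorem VarFin.funMap_wedge (v : Fin 2 → B.carrier) : funMap wedgeSymb v = B.wedge (v 0) (v 1) :=
  congrArg _ (funext fun i => by fin_cases i <;> rfl)

theorem VarFin.funMap_sqcap (v : Fin 2 → B.carrier) : funMap sqcapSymb v = B.sqcap (v 0) (v 1) :=
  congrArg _ (funext fun i => by fin_cases i <;> rfl)

theorem VarFin.wedge_const (c d : S × L) : B.wedge (B.const c) (B.const d) =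
    B.const (S.meet c.1 d.1, L.wedge c.2 d.2) :=
  (B.funMap_wedge fun i => B.const (![c, d] i)).symm.trans (B.funMap_const wedgeSymb ![c, d])

/-- A term built by `∧`. -/
def termWedge (s t : sig.Term ℕ) : sig.Term ℕ := wedgeSymb.apply₂ s t

/-- A term built by `⊓`. -/
def termSqcap (s t : sig.Term ℕ) : sig.Term ℕ := sqcapSymb.apply₂ s t

theorem VarFin.realize_termWedge (s t : sig.Term ℕ) (v : ℕ → B.carrier) :
    (termWedge s t).realize v = B.wedge (s.realize v) (t.realize v) := by
  simp [termWedge, Term.realize_functions_apply₂, VarFin.wedge]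

theorem VarFin.realize_termSqcap (s t : sig.Term ℕ) (v : ℕ → B.carrier) :
    (termSqcap s t).realize v = B.sqcap (s.realize v) (t.realize v) := by
  simp [termSqcap, Term.realize_functions_apply₂, VarFin.sqcap]

theorem realize_termWedge_self (s t : sig.Term ℕ) (v : ℕ → S × L) :
    (termWedge s t).realize v =
      (S.meet (s.realize v).1 (t.realize v).1, L.wedge (s.realize v).2 (t.realize v).2) := by
  simp [termWedge, Term.realize_functions_apply₂, funMap_wedgeSymb]

theorem realize_termSqcap_self (s t : sig.Term ℕ) (v : ℕ → S × L) :
    (termSqcap s t).realize v =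
      (S.meet (s.realize v).1 (t.realize v).1, L.sqcap (s.realize v).2 (t.realize v).2) := by
  simp [termSqcap, Term.realize_functions_apply₂, funMap_sqcapSymb]

/-- Transfer of an identity in three variables. -/
theorem VarFin.identity (s t : sig.Term ℕ)
    (h : ∀ v : ℕ → S × L, s.realize v = t.realize v) (x y z : B.carrier) :
    s.realize (fun n => if n = 0 then x else if n = 1 then y else z) =
      t.realize (fun n => if n = 0 then x else if n = 1 then y else z) :=
  B.sat s t h _

theorem VarFin.wedge_idem (x : B.carrier) : B.wedge x x = x := by
  simpa [VarFin.realize_termWedge] using B.identity (termWedge (.var 0) (.var 0)) (.var 0)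
    (fun v => by
      simp only [realize_termWedge_self, Term.realize_var]
      rcases v 0 with ⟨⟨⟩, ⟨⟩⟩ <;> rfl) x x x

theorem VarFin.wedge_comm (x y : B.carrier) : B.wedge x y = B.wedge y x := by
  simpa [VarFin.realize_termWedge] using B.identity (termWedge (.var 0) (.var 1))
    (termWedge (.var 1) (.var 0))
    (fun v => by
      simp only [realize_termWedge_self, Term.realize_var]
      rcases v 0 with ⟨⟨⟩, ⟨⟩⟩ <;> rcases v 1 with ⟨⟨⟩, ⟨⟩⟩ <;> rfl) x y x

theorem VarFin.wedge_assoc (x y z : B.carrier) :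
    B.wedge (B.wedge x y) z = B.wedge x (B.wedge y z) := by
  simpa [VarFin.realize_termWedge] using B.identity
    (termWedge (termWedge (.var 0) (.var 1)) (.var 2))
    (termWedge (.var 0) (termWedge (.var 1) (.var 2)))
    (fun v => by
      simp only [realize_termWedge_self, Term.realize_var]
      rcases v 0 with ⟨⟨⟩, ⟨⟩⟩ <;> rcases v 1 with ⟨⟨⟩, ⟨⟩⟩ <;> rcases v 2 with ⟨⟨⟩, ⟨⟩⟩ <;> rfl)
    x y z

theorem VarFin.sqcap_wedge (x y z : B.carrier) :
    B.wedge (B.sqcap x y) z = B.sqcap (B.wedge x z) (B.wedge y z) := by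
  simpa [VarFin.realize_termWedge, VarFin.realize_termSqcap] using B.identity
    (termWedge (termSqcap (.var 0) (.var 1)) (.var 2))
    (termSqcap (termWedge (.var 0) (.var 2)) (termWedge (.var 1) (.var 2)))
    (fun v => by
      simp only [realize_termWedge_self, realize_termSqcap_self, Term.realize_var]
      rcases v 0 with ⟨⟨⟩, ⟨⟩⟩ <;> rcases v 1 with ⟨⟨⟩, ⟨⟩⟩ <;> rcases v 2 with ⟨⟨⟩, ⟨⟩⟩ <;> rfl)
    x y z

theorem VarFin.sqcap_idem (x : B.carrier) : B.sqcap x x = x := by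
  simpa [VarFin.realize_termSqcap] using B.identity (termSqcap (.var 0) (.var 0)) (.var 0)
    (fun v => by
      simp only [realize_termSqcap_self, Term.realize_var]
      rcases v 0 with ⟨⟨⟩, ⟨⟩⟩ <;> rfl) x x x

theorem VarFin.sqcap_comm (x y : B.carrier) : B.sqcap x y = B.sqcap y x := by
  simpa [VarFin.realize_termSqcap] using B.identity (termSqcap (.var 0) (.var 1))
    (termSqcap (.var 1) (.var 0))
    (fun v => by
      simp only [realize_termSqcap_self, Term.realize_var]
      rcases v 0 with ⟨⟨⟩, ⟨⟩⟩ <;> rcases v 1 with ⟨⟨⟩, ⟨⟩⟩ <;> rfl) x y x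

/-- The two operations coincide on S, and `∧ a` discards the L-coordinate. Hence the filter of `a`
treats `⊓` like `∧`. -/
theorem VarFin.sqcap_wedge_a (x y : B.carrier) :
    B.wedge (B.sqcap x y) (B.const (.y, .y)) =
      B.wedge (B.wedge x y) (B.const (.y, .y)) := by
  simpa [VarFin.realize_termWedge, VarFin.realize_termSqcap, VarFin.realize_nameTerm] using
    B.identity
    (termWedge (termSqcap (.var 0) (.var 1)) (nameTerm sig (S.y, L.y)))
    (termWedge (termWedge (.var 0) (.var 1)) (nameTerm sig (S.y, L.y)))
    (fun v => by
      simp only [realize_termWedge_self, realize_termSqcap_self, realize_nameTerm_self,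
        Term.realize_var]
      rcases v 0 with ⟨⟨⟩, ⟨⟩⟩ <;> rcases v 1 with ⟨⟨⟩, ⟨⟩⟩ <;> rfl) x y x

theorem VarFin.zero_sqcap_wedge_b (x : B.carrier) :
    B.sqcap (B.const (.x, .y)) (B.wedge x (B.const (.x, .z))) = B.wedge x (B.const (.x, .z)) := by
  simpa [VarFin.realize_termWedge, VarFin.realize_termSqcap, VarFin.realize_nameTerm] using
    B.identity
    (termSqcap (nameTerm sig (S.x, L.y)) (termWedge (.var 0) (nameTerm sig (S.x, L.z))))
    (termWedge (.var 0) (nameTerm sig (S.x, L.z)))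
    (fun v => by
      simp only [realize_termWedge_self, realize_termSqcap_self, realize_nameTerm_self,
        Term.realize_var]
      rcases v 0 with ⟨⟨⟩, ⟨⟩⟩ <;> rfl) x x x

theorem VarFin.a_sqcap (x : B.carrier) : B.sqcap (B.const (.y, .y)) x = x := by
  simpa [VarFin.realize_termSqcap, VarFin.realize_nameTerm] using
    B.identity (termSqcap (nameTerm sig (S.y, L.y)) (.var 0)) (.var 0)
    (fun v => by
      simp only [realize_termSqcap_self, realize_nameTerm_self, Term.realize_var]
      rcases v 0 with ⟨⟨⟩, ⟨⟩⟩ <;> rfl) x x x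

theorem VarFin.zero_wedge (x : B.carrier) :
    B.wedge (B.const (.x, .y)) x = B.const (.x, .y) := by
  simpa [VarFin.realize_termWedge, VarFin.realize_nameTerm] using
    B.identity (termWedge (nameTerm sig (S.x, L.y)) (.var 0)) (nameTerm sig (S.x, L.y))
    (fun v => by
      simp only [realize_termWedge_self, realize_nameTerm_self, Term.realize_var]
      rcases v 0 with ⟨⟨⟩, ⟨⟩⟩ <;> rfl) x x x

/-- The order given by `∧`. -/
instance : SemilatticeInf B.carrier :=
  letI : Min B.carrier := ⟨B.wedge⟩
  SemilatticeInf.mk' B.wedge_comm B.wedge_assoc B.wedge_idem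

variable {B}

theorem VarFin.wedge_eq_inf (x y : B.carrier) : B.wedge x y = x ⊓ y := rfl

theorem VarFin.const_le_const {c d : S × L}
    (h : (S.meet c.1 d.1, L.wedge c.2 d.2) = c) : B.const c ≤ B.const d :=
  inf_eq_left.1 ((B.wedge_const c d).trans (congrArg _ h))

theorem VarFin.zero_le (x : B.carrier) : B.const (.x, .y) ≤ x := inf_eq_left.1 (B.zero_wedge x)

theorem VarFin.a_le_sqcap (x y : B.carrier) :
    B.const (.y, .y) ≤ B.sqcap x y ↔ B.const (.y, .y) ≤ x ∧ B.const (.y, .y) ≤ y := by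
  rw [← le_inf_iff, ← inf_eq_right, ← inf_eq_right (b := B.const (.y, .y))]
  exact (B.sqcap_wedge_a x y).congr_left

theorem VarFin.a_le_const (h : B.const (.x, .y) ≠ B.const (.y, .y)) (d : S × L) :
    B.const (.y, .y) ≤ B.const d ↔ d.1 = .y := by
  constructor
  · intro hd
    rcases d with ⟨⟨⟩, l⟩
    · refine absurd (le_antisymm (B.zero_le _) ?_) h
      refine (le_inf le_rfl hd).trans (ge_of_eq ?_)
      rw [← VarFin.wedge_eq_inf, B.wedge_const]
      rcases l <;> rfl
    · rfl
  · rcases d with ⟨⟨⟩, ⟨⟩⟩ <;> intro hd <;> first | exact B.const_le_const rfl | nomatch hd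

/-- By distributivity `(x ⊓ y) ∧ e` is the `⊓` of `x ∧ e` and `y ∧ e`, each of which is `o` or `e`.
As `o ⊓ e = e`, the result is `e` unless both are `o`: the operation acts as a join, as it does on
L. -/
theorem VarFin.le_sqcap_of_atom {o e : B.carrier} (ho : o < e)
    (hatom : ∀ x, o ≤ x → ¬ e ≤ x → x ⊓ e = o) (hoe : B.sqcap o e = e) {x y : B.carrier}
    (hx : o ≤ x) (hy : o ≤ y) : e ≤ B.sqcap x y ↔ e ≤ x ∨ e ≤ y := by
  have hmeet : ∀ z, e ≤ z → z ⊓ e = e := fun z => inf_eq_right.2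
  rw [← inf_eq_right, ← VarFin.wedge_eq_inf, B.sqcap_wedge, VarFin.wedge_eq_inf,
    VarFin.wedge_eq_inf]
  by_cases h1 : e ≤ x <;> by_cases h2 : e ≤ y
  · simp [h1, hmeet y h2, B.sqcap_idem]
  · simp [h1, hatom y hy h2, B.sqcap_comm e, hoe]
  · simp [h2, hatom x hx h1, hoe]
  · simp [h1, h2, hatom x hx h1, hatom y hy h2, B.sqcap_idem, ho.ne]

/-- The projection to `L`, restricted to the elements above `a` if `0` and `b` coincide in `B`,
is given by a principal filter. -/
theorem VarFin.exists_filter_generator (h : B.const (.y, .y) ≠ B.const (.y, .z)) :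
    ∃ e : B.carrier,
      (∀ d : S × L, (B.const (.x, .y) = B.const (.x, .z) → d.1 = .y) →
        (e ≤ B.const d ↔ d.2 = .z)) ∧
      ∀ x y, (B.const (.x, .y) = B.const (.x, .z) → B.const (.y, .y) ≤ x ∧ B.const (.y, .y) ≤ y) →
        (e ≤ B.sqcap x y ↔ e ≤ x ∨ e ≤ y) := by
  by_cases hb : B.const (.x, .y) = B.const (.x, .z)
  · obtain ⟨e, het, hoe, hatom⟩ := exists_relative_atom
      (lt_of_le_of_ne (B.const_le_const rfl : B.const (.y, .y) ≤ B.const (.y, .z)) h)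
    refine ⟨e, fun d hd => ?_, fun x y hxy =>
      VarFin.le_sqcap_of_atom hoe hatom (B.a_sqcap e) (hxy hb).1 (hxy hb).2⟩
    specialize hd hb
    rcases d with ⟨⟨⟩, ⟨⟩⟩
    · cases hd
    · cases hd
    · exact iff_of_false hoe.not_ge (by simp)
    · exact iff_of_true het rfl
  · obtain ⟨e, het, hoe, hatom⟩ := exists_relative_atom
      (lt_of_le_of_ne (B.zero_le (B.const (.x, .z))) hb)
    have hsq : B.sqcap (B.const (.x, .y)) e = e := by
      have := B.zero_sqcap_wedge_b e
      rwa [VarFin.wedge_eq_inf, inf_eq_left.2 het] at this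
    refine ⟨e, fun d _ => ?_, fun x y _ =>
      VarFin.le_sqcap_of_atom hoe hatom hsq (B.zero_le x) (B.zero_le y)⟩
    -- Since `e ≤ b`, only `b ∧ d` matters, and that is `0` or `b`.
    have hd : e ≤ B.const d ↔ e ≤ B.const (S.meet .x d.1, L.wedge .z d.2) := by
      rw [← B.wedge_const (.x, .z) d, VarFin.wedge_eq_inf, le_inf_iff]
      exact ⟨fun h => ⟨het, h⟩, fun h => h.2⟩
    rw [hd]
    rcases d with ⟨⟨⟩, ⟨⟩⟩
    · exact iff_of_false hoe.not_ge (by simp)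
    · exact iff_of_true het rfl
    · exact iff_of_false hoe.not_ge (by simp)
    · exact iff_of_true het rfl

/-- The retraction only has to be right in coordinates that `B` still distinguishes. If `0 = b` but
`a ≠ 1` in `B`, the second coordinate matters only over first coordinate `y`. -/
theorem VarFin.const_eq_const {c d : S × L}
    (h1 : B.const (.x, .y) ≠ B.const (.y, .y) → c.1 = d.1)
    (h2 : B.const (.y, .y) ≠ B.const (.y, .z) →
      (B.const (.x, .y) = B.const (.x, .z) → d.1 = .y) → c.2 = d.2) : B.const c = B.const d := by
  have hQP := B.ker.zero_b_of_a_one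
  refine (B.ker.rel_iff c d).2 ⟨fun h => ?_, fun h => ?_, fun h _ hd => ?_⟩
  · by_contra h'
    exact h (h1 h')
  · by_contra hP
    exact h (h2 (mt hQP hP) fun hP' => absurd hP' hP)
  · by_contra hQ
    exact h (h2 hQ fun _ => hd)

open Classical in
theorem VarFin.exists_retract_sig (B : VarFin sig (S × L)) : ∃ r : B.carrier → S × L,
    ∀ {n : ℕ} (f : sig.Functions n) (x : Fin n → B.carrier),
      B.const (r (funMap f x)) = B.const (funMap f fun i => r (x i)) := by
  obtain ⟨e, he⟩ : ∃ e : B.carrier, B.const (.y, .y) ≠ B.const (.y, .z) →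
      (∀ d : S × L, (B.const (.x, .y) = B.const (.x, .z) → d.1 = .y) →
        (e ≤ B.const d ↔ d.2 = .z)) ∧
      ∀ x y, (B.const (.x, .y) = B.const (.x, .z) → B.const (.y, .y) ≤ x ∧ B.const (.y, .y) ≤ y) →
        (e ≤ B.sqcap x y ↔ e ≤ x ∨ e ≤ y) := by
    by_cases h : B.const (.y, .y) = B.const (.y, .z)
    -- If `a = 1` in `B`, then also `0 = b`, so the second coordinate is invisible and any `e` will
    -- do.
    · exact ⟨B.const (.x, .y), fun h' => absurd h h'⟩
    · obtain ⟨e, he⟩ := B.exists_filter_generator h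
      exact ⟨e, fun _ => he⟩
  let r : B.carrier → S × L := fun x =>
    (if B.const (.y, .y) ≤ x then .y else .x, if e ≤ x then .z else .y)
  have hr1 : ∀ x, (r x).1 = if B.const (.y, .y) ≤ x then .y else .x := fun _ => rfl
  have hr2 : ∀ x, (r x).2 = if e ≤ x then .z else .y := fun _ => rfl
  have hry : ∀ x, (r x).1 = .y ↔ B.const (.y, .y) ≤ x := fun x => by
    rw [hr1]; split_ifs with h <;> simp [h]
  have meet_eq : ∀ s t : S, S.meet s t = .y ↔ s = .y ∧ t = .y := by
    rintro ⟨⟩ ⟨⟩ <;> simp [S.meet]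
  refine ⟨r, fun {n} f => Op.forall_iff (motive := fun {n} f => ∀ x : Fin n → B.carrier,
    B.const (r (funMap f x)) = B.const (funMap f fun i => r (x i))) (fun d x => ?_) (fun x => ?_)
    (fun x => ?_) f⟩
  · rw [B.funMap_name, Named.funMap_name]
    refine VarFin.const_eq_const (fun h => ?_) fun h h' => ?_
    · rw [hr1]
      simp only [B.a_le_const h]
      rcases d with ⟨⟨⟩, l⟩ <;> simp
    · rw [hr2]
      simp only [(he h).1 d h']
      rcases d with ⟨s, ⟨⟩⟩ <;> simp
  · rw [B.funMap_wedge, VarFin.wedge_eq_inf, funMap_wedgeSymb]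
    refine VarFin.const_eq_const (fun _ => ?_) fun _ _ => ?_
    · simp only [hr1, le_inf_iff]
      split_ifs <;> simp_all [S.meet]
    · simp only [hr2, le_inf_iff]
      split_ifs <;> simp_all [L.wedge]
  · rw [B.funMap_sqcap, funMap_sqcapSymb]
    refine VarFin.const_eq_const (fun _ => ?_) fun h h' => ?_
    · simp only [hr1, B.a_le_sqcap]
      split_ifs <;> simp_all [S.meet]
    · have hxy := (he h).2 (x 0) (x 1) fun hb => by
        simpa only [meet_eq, hry] using h' hb
      simp only [hr2, hxy]
      split_ifs <;> simp_all [L.sqcap]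

end Retract

theorem nonempty_homLattice_orderIso_N5 : Nonempty (HomLattice sig (S × L) ≃o N5) := by
  obtain ⟨e⟩ := nonempty_congr_orderIso_N5
  obtain ⟨e'⟩ := nonempty_homLattice_orderIso_congr (σ := sig) (A := S × L)
    VarFin.exists_retract_sig
  exact ⟨e'.trans e⟩

theorem isHomLattice_N5 : IsHomLattice N5 :=
  ⟨sig, inferInstance, S × L, inferInstance, inferInstance, inferInstance,
    nonempty_homLattice_orderIso_N5⟩

end Pentagon

/-! ### Sets of named points and partition lattices -/

section Points

/-- Operation symbols of a set with all elements named and no further operations. -/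
inductive PointOp (α : Type) : ℕ → Type
  | point (a : α) : PointOp α 0

/-- The signature with a constant for every element of `α`. -/
def pointSig (α : Type) : FirstOrder.Language.{0, 0} := ⟨PointOp α, fun _ => Empty⟩

variable {α : Type}

instance : (pointSig α).IsAlgebraic := fun _ => inferInstanceAs (IsEmpty Empty)

instance : (pointSig α).Structure α where
  funMap {n} (f : PointOp α n) := match n, f with
    | _, .point a => fun _ => a
  RelMap {_} (r : Empty) := r.elim

instance : Named (pointSig α) α where
  name := PointOp.point
  funMap_name _ _ := rfl

/-- The lattice of equivalence relations on a finite set is a homomorphism lattice. -/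
theorem isHomLattice_setoid [Finite α] [Nonempty α] : IsHomLattice (Setoid α) := by
  have hcompat : ∀ s : Setoid α, Compatible (pointSig α) s := fun s {n} f x y _ => by
    change PointOp α n at f
    cases f
    exact s.refl _
  obtain ⟨e⟩ := nonempty_homLattice_orderIso_congr (σ := pointSig α) (A := α) fun B => by
    -- With constants as the only operations, any map fixing the named elements is a retraction; the
    -- other elements go anywhere.
    refine ⟨Function.invFun B.const, fun {n} f x => ?_⟩
    change PointOp α n at f
    cases f with
    | point a =>
      exact (congrArg (fun b => B.const (Function.invFun B.const b)) (B.funMap_name a x)).trans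
        (Function.invFun_eq ⟨a, rfl⟩)
  refine ⟨pointSig α, inferInstance, α, inferInstance, inferInstance, inferInstance,
    ⟨e.trans ?_⟩⟩
  exact
    { toFun := Subtype.val
      invFun := fun s => ⟨s, hcompat s⟩
      map_rel_iff' := Iff.rfl }

end Points

/-! ### Lattices with at most five elements -/

section Classification

variable {K : Type} [Lattice K] [BoundedOrder K]

open Classical in
-- M₃ is the partition lattice of a three-element set: each atom merges one pair, and merging two
-- pairs merges all.
theorem isHomLattice_of_diamond (u v w : K)
    (cover : ∀ x : K, x = ⊥ ∨ x = ⊤ ∨ x = u ∨ x = v ∨ x = w) (huv : ¬ u ≤ v) (hvu : ¬ v ≤ u)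
    (huw : ¬ u ≤ w) (hwu : ¬ w ≤ u) (hvw : ¬ v ≤ w) (hwv : ¬ w ≤ v) : IsHomLattice K := by
  have hu : ¬ u ≤ ⊥ := fun h => huv (h.trans bot_le)
  have hv : ¬ v ≤ ⊥ := fun h => hvu (h.trans bot_le)
  have hw : ¬ w ≤ ⊥ := fun h => hwu (h.trans bot_le)
  have hu' : ¬ ⊤ ≤ u := fun h => hvu (le_top.trans h)
  have hv' : ¬ ⊤ ≤ v := fun h => huv (le_top.trans h)
  have hw' : ¬ ⊤ ≤ w := fun h => huw (le_top.trans h)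
  have htb : (⊤ : K) ≠ ⊥ := fun h => hu (le_top.trans h.le)
  have le_iff : ∀ s t : Setoid (Fin 3), s ≤ t ↔
      (s 0 1 → t 0 1) ∧ (s 0 2 → t 0 2) ∧ (s 1 2 → t 1 2) := fun s t => by
    refine ⟨fun h => ⟨fun h' => h h', fun h' => h h', fun h' => h h'⟩, fun ⟨h1, h2, h3⟩ a b h => ?_⟩
    fin_cases a <;> fin_cases b
    · exact t.refl _
    · exact h1 h
    · exact h2 h
    · exact t.symm (h1 (s.symm h))
    · exact t.refl _
    · exact h3 h
    · exact t.symm (h2 (s.symm h))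
    · exact t.symm (h3 (s.symm h))
    · exact t.refl _
  let e : Setoid (Fin 3) ↪o K := OrderEmbedding.ofMapLEIff (fun s =>
    if s 0 1 then (if s 0 2 then ⊤ else u) else if s 0 2 then v else if s 1 2 then w else ⊥)
    fun s t => by
      have hs1 : s 0 1 → s 0 2 → s 1 2 := fun h h' => s.trans (s.symm h) h'
      have hs2 : s 0 1 → s 1 2 → s 0 2 := fun h h' => s.trans h h'
      have hs3 : s 0 2 → s 1 2 → s 0 1 := fun h h' => s.trans h (s.symm h')
      have ht1 : t 0 1 → t 0 2 → t 1 2 := fun h h' => t.trans (t.symm h) h'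
      have ht2 : t 0 1 → t 1 2 → t 0 2 := fun h h' => t.trans h h'
      have ht3 : t 0 2 → t 1 2 → t 0 1 := fun h h' => t.trans h (t.symm h')
      rw [le_iff]
      split_ifs <;> simp_all
  refine (isHomLattice_setoid (α := Fin 3)).of_orderIso (RelIso.ofSurjective e fun x => ?_)
  have he : ∀ s : Setoid (Fin 3), e s =
    if s 0 1 then (if s 0 2 then ⊤ else u) else if s 0 2 then v else if s 1 2 then w else ⊥ :=
    fun _ => rfl
  rcases cover x with rfl | rfl | rfl | rfl | rfl
  · exact ⟨Setoid.ker ![0, 1, 2], by simp [he, Setoid.ker_def]⟩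
  · exact ⟨Setoid.ker ![0, 0, 0], by simp [he, Setoid.ker_def]⟩
  · exact ⟨Setoid.ker ![0, 0, 1], by simp [he, Setoid.ker_def]⟩
  · exact ⟨Setoid.ker ![0, 1, 0], by simp [he, Setoid.ker_def]⟩
  · exact ⟨Setoid.ker ![0, 1, 1], by simp [he, Setoid.ker_def]⟩

/-- Every finite chain is a homomorphism lattice. -/
theorem isHomLattice_of_total [Finite K] (total : ∀ a b : K, a ≤ b ∨ b ≤ a) : IsHomLattice K := by
  classical
  have := Fintype.ofFinite K
  -- In a chain every element other than `⊥` is join-prime, so the join of the elements not above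
  -- `p` is still not above `p`.
  refine isHomLattice_of_splitting (· ≠ ⊥)
    (fun p => (Finset.univ.filter fun a => ¬ p ≤ a).sup id) (fun p hp a => ?_) (fun a b h => ?_)
    fun p q r _ _ _ _ _ => total q r
  · refine ⟨fun h hpa => ?_, fun h => Finset.le_sup (f := id) (by simpa using h)⟩
    have key : ¬ p ≤ (Finset.univ.filter fun a => ¬ p ≤ a).sup id := by
      refine Finset.sup_induction (p := fun x => ¬ p ≤ x) (fun h => hp (le_bot_iff.1 h)) ?_ ?_
      · intro x hx y hy
        rcases total x y with h | h
        · rwa [sup_eq_right.2 h]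
        · rwa [sup_eq_left.2 h]
      · intro x hx
        simpa using hx
    exact key (hpa.trans h)
  · by_cases ha : a = ⊥
    · exact ha ▸ bot_le
    · exact h a ha le_rfl

theorem isHomLattice_of_square [Finite K] (u v : K)
    (cover : ∀ x : K, x = ⊥ ∨ x = ⊤ ∨ x = u ∨ x = v) (huv : ¬ u ≤ v) (hvu : ¬ v ≤ u) :
    IsHomLattice K := by
  classical
  have huv' : u ⊔ v = ⊤ := by
    rcases cover (u ⊔ v) with h | h | h | h
    · exact absurd (le_sup_left.trans (h.le.trans bot_le)) huv
    · exact h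
    · exact absurd (sup_eq_left.1 h) hvu
    · exact absurd (sup_eq_right.1 h) huv
  have hu : ¬ u ≤ ⊥ := fun h => huv (h.trans bot_le)
  have hv : ¬ v ≤ ⊥ := fun h => hvu (h.trans bot_le)
  have hu' : ¬ ⊤ ≤ u := fun h => hvu (le_top.trans h)
  have hv' : ¬ ⊤ ≤ v := fun h => huv (le_top.trans h)
  have hne : v ≠ u := fun h => hvu h.le
  refine isHomLattice_of_splitting (fun x => x = u ∨ x = v) (fun p => if p = u then v else u)
    ?_ (fun a b h => ?_) ?_
  · rintro p (rfl | rfl) a <;> rcases cover a with rfl | rfl | rfl | rfl <;> simp_all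
  · have h1 := h u (.inl rfl)
    have h2 := h v (.inr rfl)
    rcases cover a with rfl | rfl | rfl | rfl
    · exact bot_le
    · exact huv' ▸ sup_le (h1 le_top) (h2 le_top)
    · exact h1 le_rfl
    · exact h2 le_rfl
  · rintro p q r (rfl | rfl) (rfl | rfl) (rfl | rfl) <;> simp_all

/-- The four-element Boolean lattice with a new bottom is a homomorphism lattice. -/
theorem isHomLattice_of_square_bot [Finite K] (u v w : K)
    (cover : ∀ x : K, x = ⊥ ∨ x = ⊤ ∨ x = u ∨ x = v ∨ x = w) (huv : ¬ u ≤ v) (hvu : ¬ v ≤ u)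
    (hwu : w ≤ u) (hwv : w ≤ v) (hw : w ≠ ⊥) : IsHomLattice K := by
  classical
  have huw : ¬ u ≤ w := fun h => huv (h.trans hwv)
  have hvw : ¬ v ≤ w := fun h => hvu (h.trans hwu)
  have huv' : u ⊔ v = ⊤ := by
    rcases cover (u ⊔ v) with h | h | h | h | h
    · exact absurd (le_sup_left.trans (h.le.trans bot_le)) huv
    · exact h
    · exact absurd (sup_eq_left.1 h) hvu
    · exact absurd (sup_eq_right.1 h) huv
    · exact absurd (le_sup_left.trans h.le) huw
  have hu : ¬ u ≤ ⊥ := fun h => huv (h.trans bot_le)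
  have hv : ¬ v ≤ ⊥ := fun h => hvu (h.trans bot_le)
  have hu' : ¬ ⊤ ≤ u := fun h => hvu (le_top.trans h)
  have hv' : ¬ ⊤ ≤ v := fun h => huv (le_top.trans h)
  have hne : v ≠ u := fun h => hvu h.le
  have hne1 : u ≠ w := fun h => huw h.le
  have hne2 : v ≠ w := fun h => hvw h.le
  have htb : (⊤ : K) ≠ ⊥ := fun h => hu (le_top.trans h.le)
  have hne3 : w ≠ u := hne1.symm
  have hne4 : w ≠ v := hne2.symm
  -- The join-irreducibles form the forest with root `w` and leaves `u`, `v`. The largest element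
  -- not above `u` is `v`, and conversely; for `w` it is `⊥`.
  refine isHomLattice_of_splitting (fun x => x = u ∨ x = v ∨ x = w)
    (fun p => if p = u then v else if p = v then u else ⊥) ?_ (fun a b h => ?_) ?_
  · rintro p (rfl | rfl | rfl) a <;> rcases cover a with rfl | rfl | rfl | rfl | rfl <;> simp_all
  · have h1 := h u (.inl rfl)
    have h2 := h v (.inr (.inl rfl))
    have h3 := h w (.inr (.inr rfl))
    rcases cover a with rfl | rfl | rfl | rfl | rfl
    · exact bot_le
    · exact huv' ▸ sup_le (h1 le_top) (h2 le_top)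
    · exact h1 le_rfl
    · exact h2 le_rfl
    · exact h3 le_rfl
  · rintro p q r (rfl | rfl | rfl) (rfl | rfl | rfl) (rfl | rfl | rfl) <;> simp_all

theorem isHomLattice_of_pentagon (p q r : K)
    (cover : ∀ x : K, x = ⊥ ∨ x = ⊤ ∨ x = p ∨ x = q ∨ x = r) (hpq : p ≤ q) (hqp : ¬ q ≤ p)
    (hpr : ¬ p ≤ r) (hrp : ¬ r ≤ p) (hqr : ¬ q ≤ r) (hrq : ¬ r ≤ q) : IsHomLattice K := by
  have hp : ¬ p ≤ ⊥ := fun h => hpr (h.trans bot_le)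
  have hq : ¬ q ≤ ⊥ := fun h => hqr (h.trans bot_le)
  have hr : ¬ r ≤ ⊥ := fun h => hrp (h.trans bot_le)
  have hp' : ¬ ⊤ ≤ p := fun h => hrp (le_top.trans h)
  have hq' : ¬ ⊤ ≤ q := fun h => hrq (le_top.trans h)
  have hr' : ¬ ⊤ ≤ r := fun h => hpr (le_top.trans h)
  have htb : (⊤ : K) ≠ ⊥ := fun h => hp (le_top.trans h.le)
  let f : N5 → K
    | .bot => ⊥
    | .p => p
    | .q => q
    | .r => r
    | .top => ⊤
  let e : N5 ↪o K := OrderEmbedding.ofMapLEIff f fun x y => by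
    rw [N5.le_iff]
    rcases x <;> rcases y <;> simp_all [f, N5.join]
  refine isHomLattice_N5.of_orderIso (RelIso.ofSurjective e fun x => ?_)
  rcases cover x with rfl | rfl | rfl | rfl | rfl
  exacts [⟨.bot, rfl⟩, ⟨.top, rfl⟩, ⟨.p, rfl⟩, ⟨.q, rfl⟩, ⟨.r, rfl⟩]

/-- A lattice that is not a chain has incomparable `u`, `v`, which together with `⊥` and `⊤` leave
room for at most one more element `w`. Its position relative to `u` and `v` determines the lattice.
-/
theorem isHomLattice_of_card_le_five [Finite K] (hK : Nat.card K ≤ 5) : IsHomLattice K := by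
  classical
  have := Fintype.ofFinite K
  rw [Nat.card_eq_fintype_card] at hK
  by_cases total : ∀ a b : K, a ≤ b ∨ b ≤ a
  · exact isHomLattice_of_total total
  push Not at total
  obtain ⟨u, v, huv, hvu⟩ := total
  by_cases square : ∀ x : K, x = ⊥ ∨ x = ⊤ ∨ x = u ∨ x = v
  · exact isHomLattice_of_square u v square huv hvu
  push Not at square
  obtain ⟨w, hw, hw', hwu, hwv⟩ := square
  have cover : ∀ x : K, x = ⊥ ∨ x = ⊤ ∨ x = u ∨ x = v ∨ x = w := by
    have hub : u ≠ ⊥ := fun h => huv (h.le.trans bot_le)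
    have hvb : v ≠ ⊥ := fun h => hvu (h.le.trans bot_le)
    have hut : u ≠ ⊤ := fun h => hvu (le_top.trans h.ge)
    have hvt : v ≠ ⊤ := fun h => huv (le_top.trans h.ge)
    have hne : u ≠ v := fun h => huv h.le
    have hbt : (⊥ : K) ≠ ⊤ := fun h => hub (le_bot_iff.1 (le_top.trans h.ge))
    have hcard : ({⊥, ⊤, u, v, w} : Finset K).card = 5 := by
      rw [Finset.card_insert_of_notMem, Finset.card_insert_of_notMem,
        Finset.card_insert_of_notMem, Finset.card_insert_of_notMem, Finset.card_singleton] <;>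
        simp [hub.symm, hvb.symm, hut.symm, hvt.symm, hne, hbt, hw.symm, hw'.symm, hwu.symm,
          hwv.symm]
    have huniv := Finset.eq_univ_of_card _ (le_antisymm (Finset.card_le_univ _) (hcard ▸ hK))
    intro x
    simpa [← huniv] using Finset.mem_univ x
  have cover₁ : ∀ x : K, x = ⊥ ∨ x = ⊤ ∨ x = u ∨ x = w ∨ x = v := fun x => by
    have := cover x; tauto
  have cover₂ : ∀ x : K, x = ⊥ ∨ x = ⊤ ∨ x = w ∨ x = u ∨ x = v := fun x => by
    have := cover x; tauto
  have cover₃ : ∀ x : K, x = ⊥ ∨ x = ⊤ ∨ x = v ∨ x = w ∨ x = u := fun x => by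
    have := cover x; tauto
  have cover₄ : ∀ x : K, x = ⊥ ∨ x = ⊤ ∨ x = w ∨ x = v ∨ x = u := fun x => by
    have := cover x; tauto
  have hu : u ≤ w → ¬ w ≤ u := fun h h' => hwu (le_antisymm h' h)
  have hv : v ≤ w → ¬ w ≤ v := fun h h' => hwv (le_antisymm h' h)
  by_cases h1 : u ≤ w <;> by_cases h2 : v ≤ w
  · exact isHomLattice_of_square_top u v w cover huv hvu h1 h2 hw'
  · exact isHomLattice_of_pentagon u w v cover₁ h1 (hu h1) huv hvu (fun h => huv (h1.trans h)) h2
  · exact isHomLattice_of_pentagon v w u cover₃ h2 (hv h2) hvu huv (fun h => hvu (h2.trans h)) h1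
  · by_cases h3 : w ≤ u <;> by_cases h4 : w ≤ v
    · exact isHomLattice_of_square_bot u v w cover huv hvu h3 h4 hw
    · exact isHomLattice_of_pentagon w u v cover₂ h3 h1 h4 h2 huv hvu
    · exact isHomLattice_of_pentagon w v u cover₄ h4 h2 h3 h1 hvu huv
    · exact isHomLattice_of_diamond u v w cover huv hvu h1 h3 h2 h4

end Classification

end HomomorphismOrder

theorem mainTheorem7 :
    Nonempty (HomomorphismOrder.HomLattice HomomorphismOrder.sig
        (HomomorphismOrder.S × HomomorphismOrder.L) ≃o HomomorphismOrder.N5) ∧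
      ∀ (K : Type*) [Lattice K] [Nonempty K] [Finite K], Nat.card K ≤ 5 →
        HomomorphismOrder.IsHomLattice K := by
  refine ⟨HomomorphismOrder.nonempty_homLattice_orderIso_N5, fun K _ _ _ hK => ?_⟩
  -- `K` may live in any universe; its lattice structure is transported to a copy in `Type`, where
  -- the classification applies.
  obtain ⟨K', ⟨e⟩⟩ : ∃ K' : Type, Nonempty (K' ≃ K) := ⟨Fin (Nat.card K), ⟨(Finite.equivFin K).symm⟩⟩
  let _ : LE K' := ⟨fun a b => e a ≤ e b⟩
  let _ : LT K' := ⟨fun a b => e a < e b⟩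
  let _ : Max K' := ⟨fun a b => e.symm (e a ⊔ e b)⟩
  let _ : Min K' := ⟨fun a b => e.symm (e a ⊓ e b)⟩
  let _ : Lattice K' := e.injective.lattice e Iff.rfl Iff.rfl (fun _ _ => e.apply_symm_apply _)
    (fun _ _ => e.apply_symm_apply _)
  have : Finite K' := Finite.of_equiv K e.symm
  have : Nonempty K' := e.nonempty
  have := Fintype.ofFinite K'
  let _ : BoundedOrder K' := Fintype.toBoundedOrder K'
  exact (HomomorphismOrder.isHomLattice_of_card_le_five
    ((Nat.card_congr e).trans_le hK)).of_orderIso ⟨e, Iff.rfl⟩
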